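/- **Setting.** A dynamic network model set consists of $\Theta\subseteq\mathbb R^n$ and, for each $\theta\in\Theta$, a model $w = G(q,\theta)w + Rr + \begin{bmatrix}\tilde H(q,\theta)\\0\end{bmatrix}\tilde e$, $w_{\mathcal C}=Cw$, with internal signals $\mathcal W=\{w_1,\dots,w_L\}$, measured signals $\mathcal C\subseteq\mathcal W$ (selected by the matrix $C$), excitation signals $r_1,\dots,r_K$ entering through a matrix $R$ made of $K$ distinct columns of the identity, and white noise $\tilde e$ of dimension $|\mathcal C|$ with covariance $\tilde\Lambda(\theta)$. The entries of $G$ and $\tilde H$ are real rational functions of $z$ whose numerators and denominators have coefficients polynomial in $\theta$. For every $\theta\in\Theta$: $G$ is proper, stable and has zero diagonal; $T:=(I-G)^{-1}$ is stable; all principal minors of $I-G^\infty$ are non-zero, where $G^\infty:=\lim_{z\to\infty}G(z)$; $\tilde H$ is square, proper, stable, monic and minimum phase (its inverse has no poles in $|z|>1$); $\tilde\Lambda$ is real positive semidefinite. Put $X=\left[R\ \ \begin{smallmatrix}\tilde H\\0\end{smallmatrix}\right]$ and $\Phi(\omega)=T\begin{bmatrix}\tilde H\\0\end{bmatrix}\tilde\Lambda\begin{bmatrix}\tilde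 H\\0\end{bmatrix}^{\star}T^\star$ at $z=e^{i\omega}$. Module $G_{ji}$ is *generically identifiable from $(w_{\mathcal C},r)$* if for Lebesgue-almost all $\theta_0\in\Theta$ and all $\theta_1\in\Theta$: $CT(\theta_0)R=CT(\theta_1)R$ and $C\Phi(\cdot,\theta_0)C^\top=C\Phi(\cdot,\theta_1)C^\top$ imply $G_{ji}(\theta_0)=G_{ji}(\theta_1)$. **Assumptions.** (A1) For all $\theta\in\Theta$, $C\Phi(\omega)C^\top$ has full rank for almost all $\omega$. (A2) Different entries of $G$, $\tilde H$ have no parameter in common. (A3) Either $G(\theta)$ is strictly proper for all $\theta$, or $\tilde\Lambda(\theta)$ is diagonal for all $\theta$ and there is a permutation matrix $P$ such that $PG^\infty(\theta)P^\top$ is lower triangular for all $\theta$. (A4) Every submatrix of $[\,G-I\ \ X\,]$ that does not depend on $\theta$ has rank equal to its structural rank (the maximum rank of the matrices with the same non-zero pattern). **Graph.** The vertices are $\mathcal W\cup\mathcal X$, where $\mathcal X$ is the set of the signals in $r$ and $\tilde e$. There is an edge for each entry of $(G,R,\tilde H)$ that is not identically $0$ on $\Theta$ (entry in row $w_k$,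 column $u$: edge $u\to w_k$); it is *known* if the entry is constant on $\Theta$, otherwise *unknown*. Paths are directed, do not repeat vertices, and may consist of a single vertex. $b_{A\to B}$ is the maximum number of vertex disjoint paths from $A$ to $B$; an $A-B$ *disconnecting set* is a set of vertices that meets every path from $A$ to $B$ (it may contain vertices of $A\cup B$). $\mathcal X_j$ is the set of external signals without an unknown edge to $w_j$. $\mathcal N_i^+$ is the set of out-neighbors of $w_i$ except those to which $w_i$ has a known edge and which are moreover excited by an external signal of out-degree one through a known edge. **Theorem.** Let the model set satisfy (A1)–(A4). Let $x_i,x_j\in\mathcal X$ have out-degree one, with known edges to $w_i$ and $w_j$ respectively. Suppose that for some $\bar{\mathcal X}\subseteq\mathcal X_j\setminus\{x_j\}$ and $\bar{\mathcal C}\subseteq\mathcal C$ there is a $(\mathcal N_i^+\setminus\{w_j\})\cup\bar{\mathcal X}-\bar{\mathcal C}$ disconnecting set $\mathcal D$ such that 1. $b_{\{w_j\}\cup\mathcal D\to\bar{\mathcal C}}=|\mathcal D|+1$; 2. $b_{\bar{\mathcal X}\to\mathcal D}=|\mathcal D|$. Suppose moreover that either the noise-to-measurement map $CT\begin{bmatrix}\tilde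 H\\0\end{bmatrix}$ is minimum phase for every $\theta\in\Theta$, or no noise vertex is exploited, i.e. $x_i$, $x_j$ and all elements of $\bar{\mathcal X}$ are signals in $r$ and each out-neighbor of $w_i$ outside $\mathcal N_i^+$ is excited by a signal in $r$. Then $G_{ji}$ is generically identifiable from $(w_{\mathcal C},r)$. -/

import Mathlib

open Polynomial MeasureTheory

noncomputable section

namespace NetId

/-! ### Scalar transfer functions: real rational functions of the shift `z` -/

/-- Proper: the limit at `z = ∞` is finite. -/
def IsProper (f : RatFunc ℝ) : Prop := f.num.degree ≤ f.denom.degree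

/-- Strictly proper: the limit at `z = ∞` is zero. -/
def IsStrictlyProper (f : RatFunc ℝ) : Prop := f.num.degree < f.denom.degree

/-- Stable (discrete time): all poles lie in the open unit disc. -/
def IsStable (f : RatFunc ℝ) : Prop := ∀ z : ℂ, aeval z f.denom = 0 → ‖z‖ < 1

/-- The limit of a proper transfer function at `z = ∞`
(`RatFunc.denom` is monic, so it is the coefficient of the numerator in the degree of the
denominator). -/
def valInfty (f : RatFunc ℝ) : ℝ := f.num.coeff f.denom.natDegree

/-- The value of a transfer function at a complex point (which is not a pole). -/
def evalAt (z : ℂ) (f : RatFunc ℝ) : ℂ := RatFunc.eval (algebraMap ℝ ℂ) z f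

/-- A square transfer matrix is minimum phase if it is invertible and its inverse has no pole
outside the closed unit disc. -/
def IsMinimumPhase {m : Type} [Fintype m] [DecidableEq m] (F : Matrix m m (RatFunc ℝ)) : Prop :=
  IsUnit F.det ∧ ∀ a b, ∀ z : ℂ, aeval z (F⁻¹ a b).denom = 0 → ‖z‖ ≤ 1

/-! ### Rational parameterizations -/

/-- A transfer function parameterized in rational form by `θ ∈ ℝⁿ`: numerator and denominator are
polynomials in `z` whose coefficients are polynomials in `θ`. -/
structure ParamTF (n : ℕ) where
  num : (MvPolynomial (Fin n) ℝ)[X]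
  den : (MvPolynomial (Fin n) ℝ)[X]

/-- The denominator polynomial in `z` at the parameter `θ`. -/
def ParamTF.denAt {n : ℕ} (f : ParamTF n) (θ : Fin n → ℝ) : ℝ[X] :=
  f.den.map (MvPolynomial.eval θ)

/-- The transfer function at the parameter `θ`. -/
def ParamTF.at {n : ℕ} (f : ParamTF n) (θ : Fin n → ℝ) : RatFunc ℝ :=
  algebraMap ℝ[X] (RatFunc ℝ) (f.num.map (MvPolynomial.eval θ)) /
    algebraMap ℝ[X] (RatFunc ℝ) (f.denAt θ)

/-- The indices of the parameters that occur in the parameterization. -/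
def ParamTF.params {n : ℕ} (f : ParamTF n) : Set (Fin n) :=
  {k | ∃ d : ℕ, k ∈ (f.num.coeff d).vars ∨ k ∈ (f.den.coeff d).vars}

/-! ### Paths in a directed graph -/

/-- A directed path from `A` to `B` as the list of its vertices, none of which is repeated; a single
vertex is a path. -/
def IsPath {V : Type} (E : V → V → Prop) (A B : Set V) (p : List V) : Prop :=
  p.IsChain E ∧ p.Nodup ∧ (∃ a ∈ A, p.head? = some a) ∧ (∃ b ∈ B, p.getLast? = some b)

/-- `b_{A → B}`: the maximum number of vertex disjoint paths from `A` to `B`. -/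
def maxDisjointPaths {V : Type} (E : V → V → Prop) (A B : Set V) : ℕ :=
  sSup {k : ℕ | ∃ P : Fin k → List V, (∀ s, IsPath E A B (P s)) ∧
    ∀ s t, s ≠ t → (P s).Disjoint (P t)}

/-- `D` meets every path from `A` to `B`. -/
def IsDisconnecting {V : Type} (E : V → V → Prop) (A B D : Set V) : Prop :=
  ∀ p : List V, IsPath E A B p → ∃ v ∈ p, v ∈ D

/-- The structural rank: the maximum rank of all matrices with the same nonzero pattern. -/
def structuralRank {m k F : Type} [Fintype k] [Field F] (A : Matrix m k F) : ℕ :=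
  sSup {r : ℕ | ∃ B : Matrix m k F, (∀ a b, B a b = 0 ↔ A a b = 0) ∧ B.rank = r}

/-! ### Parameterized network model sets -/

/-- The data of a model set `{(G(θ), R, C, [H(θ); 0], Λ(θ)) | θ ∈ Θ ⊆ ℝⁿ}` with `L` internal
signals, `K` excitation signals `r`, the set `C` of measured internal signals and one noise signal
per measured internal signal. The excitation signal `r_p` enters at `w_{rpos p}`. -/
structure ModelSet (n L K : ℕ) where
  Θ : Set (Fin n → ℝ)
  G : Matrix (Fin L) (Fin L) (ParamTF n)
  rpos : Fin K ↪ Fin L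
  C : Finset (Fin L)
  H : Matrix C C (ParamTF n)
  Λ : (Fin n → ℝ) → Matrix C C ℝ

namespace ModelSet

variable {n L K : ℕ} (M : ModelSet n L K)

/-- The external vertices: excitation signals `r` (left) and noise signals `e` (right). -/
abbrev Ext : Type := Fin K ⊕ M.C

/-- All vertices: internal signals `w` (left) and external signals (right). -/
abbrev Vertex : Type := Fin L ⊕ M.Ext

/-- `G(q, θ)`. -/
def Gmat (θ : Fin n → ℝ) : Matrix (Fin L) (Fin L) (RatFunc ℝ) := fun a b => (M.G a b).at θ

/-- The noise model `H(q, θ)` of the measured signals, of size `|C| × |C|`. -/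
def Hmat (θ : Fin n → ℝ) : Matrix M.C M.C (RatFunc ℝ) := fun a b => (M.H a b).at θ

/-- The full noise model `[H; 0]`: no noise enters at the unmeasured signals. -/
def Hfull (θ : Fin n → ℝ) : Matrix (Fin L) M.C (RatFunc ℝ) :=
  fun a b => if h : a ∈ M.C then M.Hmat θ ⟨a, h⟩ b else 0

/-- The binary matrix `R`. -/
def Rmat : Matrix (Fin L) (Fin K) (RatFunc ℝ) := fun a p => if a = M.rpos p then 1 else 0

/-- The selection matrix of the measured signals. -/
def Cmat (S : Type) [Zero S] [One S] : Matrix M.C (Fin L) S := fun a b => if (a : Fin L) = b then 1 else 0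

/-- `X = [R, [H; 0]]`. -/
def Xmat (θ : Fin n → ℝ) : Matrix (Fin L) M.Ext (RatFunc ℝ) :=
  Matrix.fromCols M.Rmat (M.Hfull θ)

/-- `T = (I - G)⁻¹`. -/
def T (θ : Fin n → ℝ) : Matrix (Fin L) (Fin L) (RatFunc ℝ) := (1 - M.Gmat θ)⁻¹

/-- `lim_{z → ∞} G(z, θ)`. -/
def Ginfty (θ : Fin n → ℝ) : Matrix (Fin L) (Fin L) ℝ := (M.Gmat θ).map valInfty

/-- The spectral density `Φ(ω) = T H Λ H^⋆ T^⋆` at `z = e^{iω}`. -/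
def Φ (θ : Fin n → ℝ) (ω : ℝ) : Matrix (Fin L) (Fin L) ℂ :=
  let z : ℂ := Complex.exp (Complex.I * ω)
  let F : Matrix (Fin L) M.C ℂ := (M.T θ).map (evalAt z) * (M.Hfull θ).map (evalAt z)
  F * (M.Λ θ).map (fun x : ℝ => (x : ℂ)) * F.conjTranspose

/-- The map `C T R` from the excitation signals to the measured signals. -/
def CTR (θ : Fin n → ℝ) : Matrix M.C (Fin K) (RatFunc ℝ) :=
  M.Cmat (RatFunc ℝ) * M.T θ * M.Rmat

/-- The map `C T [H; 0]` from the noise signals to the measured signals. -/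
def CTH (θ : Fin n → ℝ) : Matrix M.C M.C (RatFunc ℝ) :=
  M.Cmat (RatFunc ℝ) * M.T θ * M.Hfull θ

/-- The spectral density `C Φ Cᵀ` of the measured signals. -/
def CΦC (θ : Fin n → ℝ) (ω : ℝ) : Matrix M.C M.C ℂ :=
  M.Cmat ℂ * M.Φ θ ω * (M.Cmat ℂ).transpose

/-- Standing requirements on every model of the set: the parameterization is well defined, `G` is
proper, stable and hollow, `(I - G)⁻¹` is stable, the network is well-posed, the noise model is
proper, stable, monic and minimum phase, and `Λ` is positive semidefinite. -/
structure IsValid : Prop where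
  den_G : ∀ θ ∈ M.Θ, ∀ a b, (M.G a b).denAt θ ≠ 0
  den_H : ∀ θ ∈ M.Θ, ∀ a b, (M.H a b).denAt θ ≠ 0
  proper_G : ∀ θ ∈ M.Θ, ∀ a b, IsProper (M.Gmat θ a b)
  stable_G : ∀ θ ∈ M.Θ, ∀ a b, IsStable (M.Gmat θ a b)
  hollow : ∀ θ ∈ M.Θ, ∀ a, M.Gmat θ a a = 0
  stable_T : ∀ θ ∈ M.Θ, ∀ a b, IsStable (M.T θ a b)
  wellPosed : ∀ θ ∈ M.Θ, ∀ S : Finset (Fin L),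
    ((1 - M.Ginfty θ).submatrix (fun a : S => (a : Fin L)) (fun a : S => (a : Fin L))).det ≠ 0
  proper_H : ∀ θ ∈ M.Θ, ∀ a b, IsProper (M.Hmat θ a b)
  stable_H : ∀ θ ∈ M.Θ, ∀ a b, IsStable (M.Hmat θ a b)
  monic_H : ∀ θ ∈ M.Θ, (M.Hmat θ).map valInfty = 1
  minPhase_H : ∀ θ ∈ M.Θ, IsMinimumPhase (M.Hmat θ)
  psd_Λ : ∀ θ ∈ M.Θ, (M.Λ θ).PosSemidef

/-- The spectrum of the measured signals has full rank at almost all frequencies. -/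
def FullRankSpectrum : Prop := ∀ θ ∈ M.Θ, ∀ᵐ ω : ℝ, (M.CΦC θ ω).rank = M.C.card

/-- The parameters of the transfer function at a position of `G` or of `H`. -/
def entryParams : (Fin L × Fin L) ⊕ (M.C × M.C) → Set (Fin n)
  | Sum.inl p => (M.G p.1 p.2).params
  | Sum.inr p => (M.H p.1 p.2).params

/-- Different transfer functions have no parameter in common. -/
def IndependentlyParameterized : Prop :=
  ∀ p p', p ≠ p' → Disjoint (M.entryParams p) (M.entryParams p')

/-- Either `G` is strictly proper, or `Λ` is diagonal and there are no algebraic loops (one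
simultaneous permutation of rows and columns makes all `G^∞(θ)` lower triangular). -/
def FeedthroughCondition : Prop :=
  (∀ θ ∈ M.Θ, ∀ a b, IsStrictlyProper (M.Gmat θ a b)) ∨
  ((∀ θ ∈ M.Θ, (M.Λ θ).IsDiag) ∧
    ∃ σ : Equiv.Perm (Fin L), ∀ θ ∈ M.Θ, ∀ a b, a < b → M.Ginfty θ (σ a) (σ b) = 0)

/-- The matrix `[G X]`; its column `u` holds the transfer functions on the edges out of `u`. -/
def edgeMat (θ : Fin n → ℝ) : Matrix (Fin L) M.Vertex (RatFunc ℝ) :=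
  Matrix.fromCols (M.Gmat θ) (M.Xmat θ)

/-- The entry of `[G X]` at row `w_k` and column `u` is known, i.e. it does not depend on `θ`. -/
def Known (u : M.Vertex) (k : Fin L) : Prop :=
  ∀ θ ∈ M.Θ, ∀ θ' ∈ M.Θ, M.edgeMat θ k u = M.edgeMat θ' k u

/-- Edges of the graph: the entries of `(G, R, H)` that are not fixed to zero. -/
def Edge (u v : M.Vertex) : Prop :=
  ∃ k : Fin L, v = Sum.inl k ∧ ¬ ∀ θ ∈ M.Θ, M.edgeMat θ k u = 0

/-- Every submatrix of `[(G - I) X]` that does not depend on `θ` has rank equal to its structural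
rank. -/
def FixedEntriesRegular : Prop :=
  ∀ (A : Finset (Fin L)) (B : Finset M.Vertex), (∀ a ∈ A, ∀ b ∈ B, M.Known b a) →
    ∀ θ ∈ M.Θ,
      let S := (Matrix.fromCols (M.Gmat θ - 1) (M.Xmat θ)).submatrix
        (fun a : A => (a : Fin L)) (fun b : B => (b : M.Vertex))
      S.rank = structuralRank S

/-- The external vertex `x` has out-degree one, with a known edge to `w_k`. -/
def ExcitesKnown (x : M.Ext) (k : Fin L) : Prop :=
  {v | M.Edge (Sum.inr x) v}.ncard = 1 ∧ M.Edge (Sum.inr x) (Sum.inl k) ∧ M.Known (Sum.inr x) k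

/-- `𝒳_j`: the external signals without an unknown edge to `w_j`. -/
def XNoUnknown (j : Fin L) : Set M.Ext := {x | M.Known (Sum.inr x) j}

/-- `𝒩_i⁺`: the out-neighbors of `w_i` except those to which `w_i` has a known edge and which are
excited by an external signal of out-degree one through a known edge. -/
def Nplus (i : Fin L) : Set (Fin L) :=
  {k | M.Edge (Sum.inl i) (Sum.inl k) ∧ ¬ (M.Known (Sum.inl i) k ∧ ∃ x, M.ExcitesKnown x k)}

/-- `b_{A → B}` in the graph of the model set. -/
def b (A B : Set M.Vertex) : ℕ := maxDisjointPaths M.Edge A B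

/-- `G_ji` is generically identifiable from `(w_C, r)`: for almost all `θ₀ ∈ Θ`, every `θ₁ ∈ Θ` with
the same `C T R` and the same `C Φ Cᵀ` has the same `G_ji`. -/
def GenericallyIdentifiable (j i : Fin L) : Prop :=
  ∀ᵐ θ₀ : Fin n → ℝ, θ₀ ∈ M.Θ → ∀ θ₁ ∈ M.Θ,
    M.CTR θ₀ = M.CTR θ₁ → (∀ ω : ℝ, M.CΦC θ₀ ω = M.CΦC θ₁ ω) →
      M.Gmat θ₀ j i = M.Gmat θ₁ j i

/-- No noise vertex is exploited for the excitation: `x_i`, `x_j` and all of `Xbar` are excitation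
signals `r`, and each out-neighbor of `w_i` left out of `𝒩_i⁺` is excited by some `r`. -/
def OnlyReferencesUsed (i : Fin L) (xi xj : M.Ext) (Xbar : Set M.Ext) : Prop :=
  xi.isLeft ∧ xj.isLeft ∧ (∀ x ∈ Xbar, x.isLeft) ∧
    ∀ k, M.Edge (Sum.inl i) (Sum.inl k) → k ∉ M.Nplus i → ∃ p, M.rpos p = k

end ModelSet

end NetId

end

/-! Consider the columns of the transfer matrix between all vertices, restricted to the rows in C̄.
The identity T(I − G) = I says that column i equals a unit vector plus the sum over k of G_ki times
column k. The columns of i, of j, of X̄ and of the out-neighbors outside 𝒩_i⁺ are determined by the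
data. The columns behind D, in particular those of 𝒩_i⁺ \ {w_j}, lie in the span of the columns of
D, both at θ₀ and at θ₁ (`IsValid.Text_mem_span`). If at θ₀ the columns of {w_j} ∪ D are
independent, some linear functional kills the columns of D but not that of w_j. If moreover X̄
supplies |D| independent columns, these observed columns span what D spans, for both parameters, so
the same functional kills the columns behind D at θ₁ too. Applied to the identity for column i, it
leaves only G_ji times a known non-zero number (`IsValid.Gmat_eq_of_indistinguishable`). Only θ₀ has
to be generic.

The rank conditions at θ₀ come from the disjoint paths. A minor of the inverse of I minus the edge
matrix is non-zero when the complementary minor of the edge matrix is, and disjoint paths give a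
matching in that complementary minor (`ae_Text_injective`). A matching makes the minor generically
non-zero (`ae_submatrix_injective`): the unknown entries vary independently, Rado's theorem reduces
nonsingularity to dimension counts, and there the fixed entries enter only through blocks that have
full structural rank. One good parameter suffices, since zero sets of non-zero polynomials are null.

Noise vertices are used only through CT[H; 0]. Under the minimum phase assumption the spectrum
determines this map up to a constant right factor (`spectral_factor_unique`), and the feedthrough
condition forces the factor to be the identity (`IsValid.CTH_eq`). -/

open Polynomial MeasureTheory

noncomputable section

namespace NetId

/-! ### Independent transversals and mixed matrices -/

section Rado

variable {F V ι : Type*} [Field F] [AddCommGroup V] [Module F V]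

/-- The span of the vectors available to the members of `I`. -/
def familySpan (F : Type*) {V ι : Type*} [Field F] [AddCommGroup V] [Module F V]
    (A : ι → Finset V) (I : Finset ι) : Submodule F V :=
  Submodule.span F (⋃ i ∈ I, (A i : Set V))

theorem familySpan_mono {A B : ι → Finset V} {I J : Finset ι} (hIJ : I ⊆ J)
    (hAB : ∀ i ∈ I, A i ⊆ B i) : familySpan F A I ≤ familySpan F B J := by
  apply Submodule.span_mono
  intro v hv
  simp only [Set.mem_iUnion] at hv ⊢
  obtain ⟨i, hi, hv⟩ := hv
  exact ⟨i, hIJ hi, hAB i hi hv⟩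

/-- **Rado's theorem** for vector spaces: an independent transversal exists as soon as every
subfamily of size `k` spans a space of dimension at least `k`. -/
theorem exists_independent_transversal [Fintype ι] [FiniteDimensional F V] (A : ι → Finset V)
    (h : ∀ I : Finset ι, I.card ≤ Module.finrank F (familySpan F A I)) :
    ∃ v : ι → V, (∀ i, v i ∈ A i) ∧ LinearIndependent F v := by
  classical
  induction hN : ∑ i, (A i).card using Nat.strong_induction_on generalizing A with
  | _ N ih =>
  by_cases hone : ∀ i, (A i).card ≤ 1
  · have hne : ∀ i, (A i).Nonempty := by
      intro i
      by_contra hemp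
      rw [Finset.not_nonempty_iff_eq_empty] at hemp
      have := h {i}
      have e : (⋃ k ∈ ({i} : Finset ι), (A k : Set V)) = ∅ := by simp [hemp]
      rw [familySpan, e] at this
      simp at this
    choose v hv using hne
    have hA : ∀ i, A i = {v i} := fun i =>
      Finset.eq_singleton_iff_unique_mem.2 ⟨hv i, fun w hw =>
        Finset.card_le_one.1 (hone i) _ hw _ (hv i)⟩
    refine ⟨v, hv, ?_⟩
    rw [linearIndependent_iff_card_le_finrank_span]
    have := h Finset.univ
    have e : (⋃ i ∈ (Finset.univ : Finset ι), (A i : Set V)) = Set.range v := by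
      ext w; simp [hA, eq_comm]
    rw [familySpan, e] at this
    exact this
  · push Not at hone
    obtain ⟨p, hp⟩ := hone
    obtain ⟨x, hx, y, hy, hxy⟩ := Finset.one_lt_card.1 hp
    have key : ∀ z ∈ A p, (∀ I : Finset ι, I.card ≤
        Module.finrank F (familySpan F (Function.update A p ((A p).erase z)) I)) →
        ∃ v : ι → V, (∀ i, v i ∈ A i) ∧ LinearIndependent F v := by
      intro z hz hI
      have hlt : ∑ i, (Function.update A p ((A p).erase z) i).card < ∑ i, (A i).card := by
        apply Finset.sum_lt_sum
        · intro i _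
          by_cases hi : i = p
          · subst hi; simpa using Finset.card_le_card (Finset.erase_subset _ _)
          · simp [hi]
        · exact ⟨p, Finset.mem_univ _, by simpa using Finset.card_erase_lt_of_mem hz⟩
      obtain ⟨v, hv, hvi⟩ := ih _ (hN ▸ hlt) _ hI rfl
      refine ⟨v, fun i => ?_, hvi⟩
      by_cases hi : i = p
      · subst hi; have := hv i; simp at this; exact this.2
      · have := hv i; simpa [hi] using this
    by_cases hX : ∀ I : Finset ι, I.card ≤
        Module.finrank F (familySpan F (Function.update A p ((A p).erase x)) I)
    · exact key x hx hX
    by_cases hY : ∀ I : Finset ι, I.card ≤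
        Module.finrank F (familySpan F (Function.update A p ((A p).erase y)) I)
    · exact key y hy hY
    -- Submodularity of dimension. Violators I and J of the two deletions both contain p. Since x ≠
    -- y, every vector of A p survives on one side, so U ⊔ W has dimension at least |I ∪ J|, while U
    -- ⊓ W has dimension at least |I ∩ J| − 1. This contradicts dim U + dim W ≤ |I| + |J| − 2.
    exfalso
    push Not at hX hY
    have memp : ∀ z, ∀ I : Finset ι, Module.finrank F
        (familySpan F (Function.update A p ((A p).erase z)) I) < I.card → p ∈ I := by
      intro z I hI
      by_contra hpI
      have : familySpan F A I ≤ familySpan F (Function.update A p ((A p).erase z)) I := by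
        apply familySpan_mono subset_rfl
        intro i hi
        have : i ≠ p := fun h => hpI (h ▸ hi)
        simp [this]
      have := Submodule.finrank_mono this
      have := h I
      omega
    obtain ⟨I, hI⟩ := hX
    obtain ⟨J, hJ⟩ := hY
    have hpI := memp x I hI
    have hpJ := memp y J hJ
    set U := familySpan F (Function.update A p ((A p).erase x)) I
    set W := familySpan F (Function.update A p ((A p).erase y)) J
    have hsup : familySpan F A (I ∪ J) ≤ U ⊔ W := by
      rw [familySpan, Submodule.span_le]
      intro v hv
      simp only [Set.mem_iUnion] at hv
      obtain ⟨i, hi, hv⟩ := hv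
      have inU : ∀ i ∈ I, v ∈ Function.update A p ((A p).erase x) i → v ∈ U ⊔ W := by
        intro i hi hv
        exact Submodule.mem_sup_left (Submodule.subset_span (Set.mem_biUnion hi hv))
      have inW : ∀ i ∈ J, v ∈ Function.update A p ((A p).erase y) i → v ∈ U ⊔ W := by
        intro i hi hv
        exact Submodule.mem_sup_right (Submodule.subset_span (Set.mem_biUnion hi hv))
      have hv' : v ∈ A i := hv
      by_cases hip : i = p
      · subst hip
        by_cases hvx : v = x
        · apply inW i hpJ; subst hvx; simp [hxy, hx]
        · apply inU i hpI; simp [hvx, hv']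
      · rcases Finset.mem_union.1 hi with hi | hi
        · apply inU i hi; simp [hip, hv']
        · apply inW i hi; simp [hip, hv']
    have hinf : familySpan F A ((I ∩ J).erase p) ≤ U ⊓ W := by
      apply le_inf
      · apply familySpan_mono
        · exact (Finset.erase_subset _ _).trans Finset.inter_subset_left
        · intro i hi; simp [(Finset.mem_erase.1 hi).1]
      · apply familySpan_mono
        · exact (Finset.erase_subset _ _).trans Finset.inter_subset_right
        · intro i hi; simp [(Finset.mem_erase.1 hi).1]
    have h1 := Submodule.finrank_mono hsup
    have h2 := Submodule.finrank_mono hinf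
    have h3 := Submodule.finrank_sup_add_finrank_inf_eq U W
    have h4 := h (I ∪ J)
    have h5 := h ((I ∩ J).erase p)
    have h6 := Finset.card_union_add_card_inter I J
    have h7 := Finset.card_erase_add_one (Finset.mem_inter.2 ⟨hpI, hpJ⟩)
    omega

end Rado

section Mixed

variable {F ι κ : Type*} [Field F] [Fintype ι] [Fintype κ]

/-- If every entry of a matrix may be chosen among two values `a i q`, `b i q`, independently of the
others, then the rows can be made independent as soon as this holds in the span of the available
rows. -/
theorem exists_choice_linearIndependent [DecidableEq κ] (a b : ι → κ → F)
    (h : ∀ I : Finset ι, I.card ≤ Module.finrank F (Submodule.span F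
      (a '' I ∪ {v | ∃ i ∈ I, ∃ q, a i q ≠ b i q ∧ v = Pi.single q 1}))) :
    ∃ c : ι → κ → Bool, LinearIndependent F (fun i q => if c i q then a i q else b i q) := by
  classical
  let A : ι → Finset (κ → F) := fun i =>
    Finset.univ.image (fun c : κ → Bool => fun q => if c q then a i q else b i q)
  obtain ⟨v, hv, hvi⟩ := exists_independent_transversal (F := F) A (by
    intro I
    refine (h I).trans (Submodule.finrank_mono (Submodule.span_le.2 ?_))
    have hmem : ∀ i ∈ I, ∀ c : κ → Bool,
        (fun q => if c q then a i q else b i q) ∈ familySpan F A I := by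
      intro i hi c
      exact Submodule.subset_span (Set.mem_biUnion hi (Finset.mem_coe.2
        (Finset.mem_image_of_mem _ (Finset.mem_univ c))))
    rintro w (⟨i, hi, rfl⟩ | ⟨i, hi, q, hq, rfl⟩)
    · simpa using hmem i hi (fun _ => true)
    · have h1 := hmem i hi (fun _ => true)
      -- Two available rows that differ in the entry q only: their difference is a non-zero multiple
      -- of the unit vector at q.
      have h2 := hmem i hi (fun q' => q' ≠ q)
      have h3 := Submodule.smul_mem _ (a i q - b i q)⁻¹ (Submodule.sub_mem _ h1 h2)
      refine Set.mem_of_eq_of_mem ?_ h3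
      ext q'
      by_cases hqq : q' = q
      · subst hqq; simp [inv_mul_cancel₀ (sub_ne_zero.2 hq)]
      · simp [hqq])
  simp only [A, Finset.mem_image, Finset.mem_univ, true_and] at hv
  choose c hc using hv
  refine ⟨c, ?_⟩
  exact (funext hc : (fun i q => if c i q then a i q else b i q) = v) ▸ hvi

/-- A matching inside the nonzero pattern bounds the structural rank from below. -/
theorem card_le_structuralRank {m k t F : Type} [Fintype m] [Fintype k] [Fintype t] [Field F]
    [CharZero F] (A : Matrix m k F) (r : t → m) (s : t → k) (hr : Function.Injective r)
    (hs : Function.Injective s) (hA : ∀ x, A (r x) (s x) ≠ 0) :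
    Fintype.card t ≤ structuralRank A := by
  classical
  -- The values 1 and 2 are distinct and non-zero in characteristic zero, so any choice keeps the
  -- pattern, and every matched position is free.
  obtain ⟨c, hc⟩ := exists_choice_linearIndependent (F := F)
    (fun x q => if A (r x) q = 0 then 0 else 1) (fun x q => if A (r x) q = 0 then 0 else 2) (by
      intro J
      have hli : LinearIndependent F (fun x : J => (Pi.single (s x) 1 : k → F)) := by
        have := (Pi.basisFun F k).linearIndependent.comp (fun x : J => s x)
          (hs.comp Subtype.val_injective)
        convert this using 1
        ext i : 1
        simp
      have := finrank_span_eq_card hli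
      rw [Fintype.card_coe] at this
      rw [← this]
      apply Submodule.finrank_mono
      apply Submodule.span_mono
      rintro _ ⟨i, rfl⟩
      right
      refine ⟨i, i.2, s i, ?_, rfl⟩
      simp [hA i])
  let B : Matrix m k F := fun i q => if h : ∃ x, r x = i then
    (if c h.choose q then (if A i q = 0 then 0 else 1) else (if A i q = 0 then 0 else 2)) else
      (if A i q = 0 then 0 else 1)
  have hB : Fintype.card t ≤ B.rank := by
    rw [← finrank_span_eq_card hc, Matrix.rank_eq_finrank_span_row]
    apply Submodule.finrank_mono
    apply Submodule.span_mono
    rintro _ ⟨x, rfl⟩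
    refine ⟨r x, ?_⟩
    ext q
    have hex : ∃ y, r y = r x := ⟨x, rfl⟩
    have hch : hex.choose = x := hr hex.choose_spec
    simp only [B, Matrix.row, dif_pos hex, hch]
  refine hB.trans (le_csSup ⟨Fintype.card k, ?_⟩ ⟨B, ?_, rfl⟩)
  · rintro r ⟨B, _, rfl⟩
    exact B.rank_le_card_width
  · intro i q
    by_cases hz : A i q = 0
    · simp [B, hz]
    · simp only [B, hz, if_false, iff_false]
      split_ifs <;> simp

/-- The dimension count for the rows of a mixed matrix: free entries in the columns outside the
range of `s` and a fixed block on the columns in that range. -/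
theorem rank_add_card_le_finrank_span [DecidableEq κ] {m k : Type*} [Fintype m] [Fintype k]
    (B : Matrix m k F) (s : k → κ) (hs : Function.Injective s) (S : Submodule F (κ → F))
    (hB : ∀ x, ∃ v ∈ S, ∀ y, v (s y) = B x y)
    (hJ : ∀ q, q ∉ Set.range s → Pi.single q 1 ∈ S) :
    B.rank + (Fintype.card κ - Fintype.card k) ≤ Module.finrank F S := by
  classical
  let π : (κ → F) →ₗ[F] (k → F) := LinearMap.funLeft F F s
  -- Rank–nullity for the projection to the fixed columns: its image contains the rows of `B`, its
  -- kernel the unit vectors of the free columns.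
  have h1 := LinearMap.finrank_range_add_finrank_ker (π.domRestrict S)
  have h2 : B.rank ≤ Module.finrank F (LinearMap.range (π.domRestrict S)) := by
    rw [Matrix.rank_eq_finrank_span_row]
    apply Submodule.finrank_mono
    rw [Submodule.span_le]
    rintro _ ⟨x, rfl⟩
    obtain ⟨v, hv, hvB⟩ := hB x
    exact ⟨⟨v, hv⟩, funext hvB⟩
  have h3 : Fintype.card κ - Fintype.card k ≤
      Module.finrank F (LinearMap.ker (π.domRestrict S)) := by
    let f : {q // q ∉ Set.range s} → LinearMap.ker (π.domRestrict S) := fun q =>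
      ⟨⟨Pi.single (q : κ) 1, hJ q q.2⟩, by
        ext y
        have : s y ≠ q := fun h => q.2 ⟨y, h⟩
        simp [π, LinearMap.funLeft, this]⟩
    have hf : LinearIndependent F f := by
      apply LinearIndependent.of_comp (S.subtype ∘ₗ (LinearMap.ker (π.domRestrict S)).subtype)
      have := (Pi.basisFun F κ).linearIndependent.comp
        (fun i : {q // q ∉ Set.range s} => (i : κ)) Subtype.val_injective
      convert this using 1
      ext i : 1
      simp [f]
    have := hf.fintype_card_le_finrank
    rwa [Fintype.card_subtype_compl, ← Set.card_range_of_injective hs] at *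
  omega

end Mixed

/-! ### Generic properties of rational parameterizations -/

/-- The zero set of a nonzero real polynomial is a null set. -/
theorem volume_zeros_mvPolynomial {n : ℕ} (p : MvPolynomial (Fin n) ℝ) (hp : p ≠ 0) :
    volume {θ : Fin n → ℝ | MvPolynomial.eval θ p = 0} = 0 := by
  induction n with
  | zero =>
    obtain ⟨c, rfl⟩ := MvPolynomial.C_surjective (Fin 0) p
    have hc : c ≠ 0 := fun h => hp (by simp [h])
    simp [hc]
  | succ n ih =>
    -- Fubini along the first coordinate: as a polynomial in the first variable, `q` has finitely
    -- many roots among the real constants, and for every other value the slice is a non-zero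
    -- polynomial in n variables.
    set q := MvPolynomial.finSuccEquiv ℝ n p with hq
    have hq0 : q ≠ 0 := by simpa [hq] using hp
    have hmp := volume_preserving_piFinSuccAbove (fun _ : Fin (n + 1) => ℝ) 0
    set s : Set (ℝ × (Fin n → ℝ)) :=
      {y | MvPolynomial.eval (Fin.cons y.1 y.2 : Fin (n + 1) → ℝ) p = 0} with hs
    have hsm : MeasurableSet s := by
      apply IsClosed.measurableSet
      apply isClosed_eq _ continuous_const
      apply (MvPolynomial.continuous_eval p).comp
      apply continuous_pi
      intro k
      refine Fin.cases ?_ (fun k => ?_) k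
      · simpa using continuous_fst
      · simp only [Fin.cons_succ]; fun_prop
    have hpre : {θ : Fin (n + 1) → ℝ | MvPolynomial.eval θ p = 0} =
        (MeasurableEquiv.piFinSuccAbove (fun _ : Fin (n + 1) => ℝ) 0) ⁻¹' s := by
      ext θ
      simp only [hs, Set.mem_ofPred_eq, Set.mem_preimage, MeasurableEquiv.piFinSuccAbove_apply]
      simp [Fin.insertNthEquiv]
    rw [hpre, hmp.measure_preimage hsm.nullMeasurableSet, Measure.volume_eq_prod,
      Measure.measure_prod_null hsm]
    have hfin : {x : ℝ | q.eval (MvPolynomial.C x) = 0}.Finite := by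
      have : {x : ℝ | q.eval (MvPolynomial.C x) = 0} =
          (MvPolynomial.C : ℝ →+* MvPolynomial (Fin n) ℝ) ⁻¹' {y | q.IsRoot y} := rfl
      rw [this]
      exact (Polynomial.finite_setOfPred_isRoot hq0).preimage
        (MvPolynomial.C_injective (Fin n) ℝ).injOn
    have hae : ∀ᵐ x : ℝ, x ∉ {x : ℝ | q.eval (MvPolynomial.C x) = 0} :=
      measure_eq_zero_iff_ae_notMem.1 (hfin.measure_zero _)
    filter_upwards [hae] with x hx
    have := ih (q.eval (MvPolynomial.C x)) hx
    rw [Pi.zero_apply, ← this]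
    congr 1
    ext θ
    simp only [hs, Set.mem_preimage, Set.mem_ofPred_eq]
    rw [MvPolynomial.eval_eq_eval_mv_eval', ← hq, Polynomial.eval_map, Polynomial.eval,
      Polynomial.hom_eval₂]
    simp

/-- `f` is given on `Ω` by one quotient of polynomials in `z` with coefficients polynomial in the
parameters. -/
def IsRationalFamily {n : ℕ} (Ω : Set (Fin n → ℝ)) (f : (Fin n → ℝ) → RatFunc ℝ) : Prop :=
  ∃ N D : (MvPolynomial (Fin n) ℝ)[X], ∀ θ ∈ Ω, D.map (MvPolynomial.eval θ) ≠ 0 ∧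
    f θ = algebraMap ℝ[X] (RatFunc ℝ) (N.map (MvPolynomial.eval θ)) /
      algebraMap ℝ[X] (RatFunc ℝ) (D.map (MvPolynomial.eval θ))

namespace IsRationalFamily

variable {n : ℕ} {Ω : Set (Fin n → ℝ)} {f g : (Fin n → ℝ) → RatFunc ℝ}

theorem intCast (k : ℤ) : IsRationalFamily Ω (fun _ => (k : RatFunc ℝ)) :=
  ⟨k, 1, fun θ _ => ⟨by simp, by simp⟩⟩

theorem add (hf : IsRationalFamily Ω f) (hg : IsRationalFamily Ω g) :
    IsRationalFamily Ω (fun θ => f θ + g θ) := by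
  obtain ⟨N, D, h⟩ := hf
  obtain ⟨N', D', h'⟩ := hg
  refine ⟨N * D' + D * N', D * D', fun θ hθ => ?_⟩
  obtain ⟨h1, h2⟩ := h θ hθ
  obtain ⟨h1', h2'⟩ := h' θ hθ
  refine ⟨by simp [h1, h1'], ?_⟩
  simp only [h2, h2']
  rw [div_add_div _ _ (RatFunc.algebraMap_ne_zero h1) (RatFunc.algebraMap_ne_zero h1')]
  simp

theorem mul (hf : IsRationalFamily Ω f) (hg : IsRationalFamily Ω g) :
    IsRationalFamily Ω (fun θ => f θ * g θ) := by
  obtain ⟨N, D, h⟩ := hf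
  obtain ⟨N', D', h'⟩ := hg
  refine ⟨N * N', D * D', fun θ hθ => ?_⟩
  obtain ⟨h1, h2⟩ := h θ hθ
  obtain ⟨h1', h2'⟩ := h' θ hθ
  refine ⟨by simp [h1, h1'], ?_⟩
  simp only [h2, h2']
  rw [div_mul_div_comm]
  simp

theorem sum {ι : Type*} (s : Finset ι) {f : ι → (Fin n → ℝ) → RatFunc ℝ}
    (h : ∀ i ∈ s, IsRationalFamily Ω (f i)) : IsRationalFamily Ω (fun θ => ∑ i ∈ s, f i θ) := by
  classical
  induction s using Finset.induction_on with
  | empty => simpa using intCast (Ω := Ω) 0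
  | insert a s ha ih =>
    simp only [Finset.sum_insert ha]
    exact (h a (by simp)).add (ih fun i hi => h i (by simp [hi]))

theorem prod {ι : Type*} (s : Finset ι) {f : ι → (Fin n → ℝ) → RatFunc ℝ}
    (h : ∀ i ∈ s, IsRationalFamily Ω (f i)) : IsRationalFamily Ω (fun θ => ∏ i ∈ s, f i θ) := by
  classical
  induction s using Finset.induction_on with
  | empty => simpa using intCast (Ω := Ω) 1
  | insert a s ha ih =>
    simp only [Finset.prod_insert ha]
    exact (h a (by simp)).mul (ih fun i hi => h i (by simp [hi]))

theorem det {ι : Type*} [Fintype ι] [DecidableEq ι] {A : (Fin n → ℝ) → Matrix ι ι (RatFunc ℝ)}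
    (h : ∀ a b, IsRationalFamily Ω (fun θ => A θ a b)) :
    IsRationalFamily Ω (fun θ => (A θ).det) := by
  simp only [Matrix.det_apply']
  exact sum _ fun σ _ => (intCast _).mul (prod _ fun i _ => h _ _)

/-- A rational family that does not vanish at one parameter vanishes almost nowhere. -/
theorem ae_ne_zero (hf : IsRationalFamily Ω f) {θ' : Fin n → ℝ} (hθ' : θ' ∈ Ω) (h0 : f θ' ≠ 0) :
    ∀ᵐ θ : Fin n → ℝ, θ ∈ Ω → f θ ≠ 0 := by
  obtain ⟨N, D, h⟩ := hf
  have hN : N.map (MvPolynomial.eval θ') ≠ 0 := by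
    intro hN
    exact h0 (by rw [(h θ' hθ').2, hN]; simp)
  obtain ⟨d, hd⟩ : ∃ d, (N.map (MvPolynomial.eval θ')).coeff d ≠ 0 := by
    by_contra! hall
    exact hN (Polynomial.ext (by simpa using hall))
  rw [Polynomial.coeff_map] at hd
  have hd0 : N.coeff d ≠ 0 := fun h => hd (by simp [h])
  have hae : ∀ᵐ θ : Fin n → ℝ, θ ∉ {θ : Fin n → ℝ | MvPolynomial.eval θ (N.coeff d) = 0} :=
    measure_eq_zero_iff_ae_notMem.1 (volume_zeros_mvPolynomial _ hd0)
  filter_upwards [hae] with θ hθ hΩ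
  rw [(h θ hΩ).2]
  refine div_ne_zero (RatFunc.algebraMap_ne_zero fun hz => hθ ?_)
    (RatFunc.algebraMap_ne_zero (h θ hΩ).1)
  have := congrArg (fun p => p.coeff d) hz
  simpa using this

end IsRationalFamily

theorem ParamTF.map_eval_congr {n : ℕ} (p : (MvPolynomial (Fin n) ℝ)[X]) {θ θ' : Fin n → ℝ}
    (h : ∀ k, (∃ d, k ∈ (p.coeff d).vars) → θ k = θ' k) :
    p.map (MvPolynomial.eval θ) = p.map (MvPolynomial.eval θ') := by
  ext d
  rw [Polynomial.coeff_map, Polynomial.coeff_map]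
  exact MvPolynomial.eval₂Hom_congr' rfl (fun k hk _ => h k ⟨d, hk⟩) rfl

theorem ParamTF.denAt_congr {n : ℕ} (f : ParamTF n) {θ θ' : Fin n → ℝ}
    (h : ∀ k ∈ f.params, θ k = θ' k) : f.denAt θ = f.denAt θ' :=
  map_eval_congr _ fun k ⟨d, hd⟩ => h k ⟨d, Or.inr hd⟩

theorem ParamTF.at_congr {n : ℕ} (f : ParamTF n) {θ θ' : Fin n → ℝ}
    (h : ∀ k ∈ f.params, θ k = θ' k) : f.at θ = f.at θ' := by
  rw [ParamTF.at, ParamTF.at, f.denAt_congr h,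
    map_eval_congr f.num fun k ⟨d, hd⟩ => h k ⟨d, Or.inl hd⟩]

/-! ### Generic nonsingularity of submatrices of [(G − I) X]. -/

namespace ModelSet

variable {n L K : ℕ} (M : ModelSet n L K)

/-- The parameters at which no denominator of the parameterization vanishes. -/
def domain : Set (Fin n → ℝ) :=
  {θ | (∀ a b, (M.G a b).denAt θ ≠ 0) ∧ ∀ a b, (M.H a b).denAt θ ≠ 0}

/-- The matrix `[(G - I) X]`. -/
def sysMat (θ : Fin n → ℝ) : Matrix (Fin L) M.Vertex (RatFunc ℝ) :=
  Matrix.fromCols (M.Gmat θ - 1) (M.Xmat θ)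

variable {M}

theorem IsValid.subset_domain (hM : M.IsValid) : M.Θ ⊆ M.domain :=
  fun θ hθ => ⟨hM.den_G θ hθ, hM.den_H θ hθ⟩

theorem sysMat_eq (θ : Fin n → ℝ) (a : Fin L) (v : M.Vertex) :
    M.sysMat θ a v = M.edgeMat θ a v - if v = Sum.inl a then 1 else 0 := by
  rcases v with b | x
  · simp [sysMat, edgeMat, Matrix.one_apply, eq_comm]
  · simp [sysMat, edgeMat]

theorem isRationalFamily_sysMat (a : Fin L) (v : M.Vertex) :
    IsRationalFamily M.domain (fun θ => M.sysMat θ a v) := by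
  have hG : ∀ b, IsRationalFamily M.domain (fun θ => M.Gmat θ a b) := fun b =>
    ⟨(M.G a b).num, (M.G a b).den, fun θ hθ => ⟨hθ.1 a b, rfl⟩⟩
  rcases v with b | p | c
  · by_cases hab : a = b
    · have := (hG b).add (IsRationalFamily.intCast (-1))
      simpa [sysMat, Matrix.one_apply, hab, sub_eq_add_neg] using this
    · simpa [sysMat, Matrix.one_apply, hab] using hG b
  · by_cases hap : a = M.rpos p
    · simpa [sysMat, Xmat, Rmat, hap] using IsRationalFamily.intCast (Ω := M.domain) 1
    · simpa [sysMat, Xmat, Rmat, hap] using IsRationalFamily.intCast (Ω := M.domain) 0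
  · by_cases ha : a ∈ M.C
    · have : IsRationalFamily M.domain (fun θ => M.Hmat θ ⟨a, ha⟩ c) :=
        ⟨(M.H ⟨a, ha⟩ c).num, (M.H ⟨a, ha⟩ c).den, fun θ hθ => ⟨hθ.2 _ _, rfl⟩⟩
      simpa [sysMat, Xmat, Hfull, ha] using this
    · simpa [sysMat, Xmat, Hfull, ha] using IsRationalFamily.intCast (Ω := M.domain) 0

/-- Since different entries share no parameter, their parameters can be chosen separately. -/
theorem exists_glued_parameter (hindep : M.IndependentlyParameterized) (hΘ : M.Θ ⊆ M.domain)
    (c : Fin L → M.Vertex → Fin n → ℝ) (hc : ∀ a v, c a v ∈ M.Θ) :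
    ∃ θ ∈ M.domain, ∀ a v, M.sysMat θ a v = M.sysMat (c a v) a v := by
  classical
  let c' : (Fin L × Fin L) ⊕ (M.C × M.C) → Fin n → ℝ := fun e => match e with
    | Sum.inl p => c p.1 (Sum.inl p.2)
    | Sum.inr p => c p.1 (Sum.inr (Sum.inr p.2))
  have hc' : ∀ e, c' e ∈ M.domain := by
    rintro (p | p) <;> exact hΘ (hc _ _)
  -- By disjointness each index belongs to at most one entry, so the choice is forced; 0 is a
  -- harmless default elsewhere. The glued point may leave `M.Θ`, but the denominators stay
  -- non-zero, which is all that genericity requires.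
  let θ : Fin n → ℝ := fun k =>
    if h : ∃ e, k ∈ M.entryParams e then c' h.choose k else 0
  have hθ : ∀ e, ∀ k ∈ M.entryParams e, θ k = c' e k := by
    intro e k hk
    have hex : ∃ e, k ∈ M.entryParams e := ⟨e, hk⟩
    have : hex.choose = e := by
      by_contra hne
      exact Set.disjoint_left.1 (hindep _ _ hne) hex.choose_spec hk
    simp only [θ, dif_pos hex, this]
  have hG : ∀ a b, M.Gmat θ a b = M.Gmat (c a (Sum.inl b)) a b := fun a b =>
    (M.G a b).at_congr (hθ (Sum.inl (a, b)))
  have hH : ∀ a b, M.Hmat θ a b = M.Hmat (c a (Sum.inr (Sum.inr b))) a b := fun a b =>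
    (M.H a b).at_congr (hθ (Sum.inr (a, b)))
  refine ⟨θ, ⟨fun a b => ?_, fun a b => ?_⟩, fun a v => ?_⟩
  · rw [(M.G a b).denAt_congr (hθ (Sum.inl (a, b)))]
    exact (hc' (Sum.inl (a, b))).1 a b
  · rw [(M.H a b).denAt_congr (hθ (Sum.inr (a, b)))]
    exact (hc' (Sum.inr (a, b))).2 a b
  · rcases v with b | p | x
    · simp [sysMat, hG]
    · simp [sysMat, Xmat]
    · by_cases ha : a ∈ M.C
      · simp [sysMat, Xmat, Hfull, ha, hH]
      · simp [sysMat, Xmat, Hfull, ha]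

/-- A matching in the pattern of a square submatrix of `[(G - I) X]` makes the submatrix generically
nonsingular. -/
theorem ae_submatrix_injective (hM : M.IsValid) (hindep : M.IndependentlyParameterized)
    (hfixed : M.FixedEntriesRegular) (R : Finset (Fin L)) (Q : Finset M.Vertex)
    (hcard : Q.card = R.card) (σ : Fin L → M.Vertex) (hσ : Set.InjOn σ R)
    (hσQ : ∀ a ∈ R, σ a ∈ Q) (hσE : ∀ a ∈ R, σ a = Sum.inl a ∨ M.Edge (σ a) (Sum.inl a)) :
    ∀ᵐ θ : Fin n → ℝ, θ ∈ M.Θ → ∀ u : M.Vertex → RatFunc ℝ, (∀ v ∉ Q, u v = 0) →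
      (∀ a ∈ R, ∑ v, M.sysMat θ a v * u v = 0) → u = 0 := by
  classical
  rcases M.Θ.eq_empty_or_nonempty with hempty | ⟨θb, hθb⟩
  · simp [hempty]
  -- An unknown entry gets two parameters at which its values differ; a known one is read at the
  -- base point `θb`.
  have hch : ∀ a v, ∃ α ∈ M.Θ, ∃ β ∈ M.Θ, (M.Known v a → α = θb) ∧
      (¬ M.Known v a → M.sysMat α a v ≠ M.sysMat β a v) := by
    intro a v
    by_cases hk : M.Known v a
    · exact ⟨θb, hθb, θb, hθb, fun _ => rfl, fun h => absurd hk h⟩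
    · have hk' := hk
      unfold Known at hk'
      push Not at hk'
      obtain ⟨α, hα, β, hβ, hne⟩ := hk'
      refine ⟨α, hα, β, hβ, fun h => absurd h hk, fun _ => ?_⟩
      rw [sysMat_eq, sysMat_eq]
      exact fun h => hne (sub_left_injective h)
  choose α hα β hβ hαb hαβ using hch
  obtain ⟨c, hc⟩ := exists_choice_linearIndependent (F := RatFunc ℝ) (ι := R) (κ := Q)
    (fun a q => M.sysMat (α a q) a q) (fun a q => M.sysMat (β a q) a q) (by
      intro I
      let A : Finset (Fin L) := I.map (Function.Embedding.subtype _)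
      -- The columns of `Q` that are known on all rows of `A`. On this block rank equals structural
      -- rank; every other column of `Q` has an unknown entry in `A` and contributes a unit vector.
      let B : Finset M.Vertex := Q.filter (fun q => ∀ a ∈ A, M.Known q a)
      have hAR : ∀ a ∈ A, a ∈ R := by
        intro a ha
        simp only [A, Finset.mem_map] at ha
        obtain ⟨x, _, rfl⟩ := ha
        exact x.2
      have hAI : ∀ a (ha : a ∈ A), (⟨a, hAR a ha⟩ : R) ∈ I := by
        intro a ha
        simp only [A, Finset.mem_map] at ha
        obtain ⟨x, hx, rfl⟩ := ha
        exact hx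
      have hIA : ∀ a ∈ I, (a : Fin L) ∈ A := fun a ha => Finset.mem_map_of_mem _ ha
      have hBQ : B ⊆ Q := Finset.filter_subset _ _
      set S := (M.sysMat θb).submatrix (fun a : A => (a : Fin L)) (fun b : B => (b : M.Vertex))
        with hS
      have hrank : S.rank = structuralRank S :=
        hfixed A B (fun a ha b hb => (Finset.mem_filter.1 hb).2 a ha) θb hθb
      have hcount := rank_add_card_le_finrank_span S
        (fun q : B => (⟨q, hBQ q.2⟩ : Q)) (fun x y h => Subtype.ext (by simpa using h))
        (Submodule.span (RatFunc ℝ) ((fun (a : R) (q : Q) => M.sysMat (α a q) a q) '' I ∪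
          {v | ∃ i ∈ I, ∃ q : Q, M.sysMat (α i q) i q ≠ M.sysMat (β i q) i q ∧
            v = Pi.single q 1})) (by
          intro x
          refine ⟨fun q => M.sysMat (α x q) x q,
            Submodule.subset_span (Or.inl ⟨⟨x, hAR x x.2⟩, hAI x x.2, rfl⟩), fun y => ?_⟩
          simp only [hS, Matrix.submatrix_apply]
          rw [hαb x y ((Finset.mem_filter.1 y.2).2 x x.2)]) (by
          intro q hq
          apply Submodule.subset_span
          right
          have : (q : M.Vertex) ∉ B := fun h => hq ⟨⟨q, h⟩, rfl⟩
          simp only [B, Finset.mem_filter, q.2, true_and] at this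
          push Not at this
          obtain ⟨a, ha, hk⟩ := this
          exact ⟨⟨a, hAR a ha⟩, hAI a ha, q, hαβ a q hk, rfl⟩)
      refine le_trans ?_ hcount
      -- Rows matched into `B` are counted by the structural rank of the fixed block, and the
      -- remaining rows inject into `Q \ B`. Together they account for all of `A`, which is Rado's
      -- condition.
      let t := {a : A // σ a ∈ B}
      have hmatch := card_le_structuralRank S (fun x : t => x.1)
        (fun x : t => (⟨σ x.1, x.2⟩ : B)) Subtype.val_injective
        (fun x y h => Subtype.ext (Subtype.ext (hσ (hAR _ x.1.2) (hAR _ y.1.2)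
          (congrArg Subtype.val h)))) (by
          rintro ⟨⟨a, ha⟩, hb⟩
          simp only [hS, Matrix.submatrix_apply]
          rw [sysMat_eq]
          by_cases hself : σ a = Sum.inl a
          · simp [hself, edgeMat, hM.hollow θb hθb]
          · rcases hσE a (hAR a ha) with h | ⟨k, hk, hE⟩
            · exact absurd h hself
            · obtain rfl := Sum.inl_injective hk
              simp only [hself, if_false, sub_zero]
              intro h0
              -- A known entry that vanishes at `θb` vanishes on all of `M.Θ`, so it carries no
              -- edge.
              exact hE fun θ hθ => ((Finset.mem_filter.1 hb).2 a ha θ hθ θb hθb).trans h0)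
      have h1 : A.card = I.card := Finset.card_map _
      have h2 : Fintype.card t = (A.filter (fun a => σ a ∈ B)).card := by
        rw [← Fintype.card_coe]
        exact Fintype.card_congr ⟨fun x => ⟨x.1, Finset.mem_filter.2 ⟨x.1.2, x.2⟩⟩,
          fun x => ⟨⟨x, (Finset.mem_filter.1 x.2).1⟩, (Finset.mem_filter.1 x.2).2⟩,
          fun _ => rfl, fun _ => rfl⟩
      have h3 : (A.filter (fun a => ¬ σ a ∈ B)).card ≤ (Q \ B).card := by
        apply Finset.card_le_card_of_injOn σ
        · intro a ha
          have ha := Finset.mem_filter.1 ha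
          exact Finset.mem_sdiff.2 ⟨hσQ a (hAR a ha.1), ha.2⟩
        · intro a ha b hb h
          exact hσ (hAR a (Finset.mem_filter.1 ha).1) (hAR b (Finset.mem_filter.1 hb).1) h
      have h4 := Finset.card_filter_add_card_filter_not (s := A) (fun a => σ a ∈ B)
      have h5 := Finset.card_sdiff_of_subset hBQ
      rw [Fintype.card_coe, Fintype.card_coe]
      omega)
  -- One parameter realizes the entrywise choice; there the determinant is non-zero, hence it is
  -- non-zero almost everywhere.
  obtain ⟨θs, hθs, hglue⟩ := exists_glued_parameter hindep hM.subset_domain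
    (fun a v => if h : a ∈ R ∧ v ∈ Q then
      (if c ⟨a, h.1⟩ ⟨v, h.2⟩ then α a v else β a v) else θb) (by
      intro a v
      split_ifs
      exacts [hα a v, hβ a v, hθb])
  have hRQ : Fintype.card R = Fintype.card Q := by
    rw [Fintype.card_coe, Fintype.card_coe, hcard]
  let e : R ≃ Q := Fintype.equivOfCardEq hRQ
  let S : (Fin n → ℝ) → Matrix R R (RatFunc ℝ) := fun θ =>
    (M.sysMat θ).submatrix (fun a => (a : Fin L)) (fun a => (e a : M.Vertex))
  have hSs : (S θs).det ≠ 0 := by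
    have hli : LinearIndependent (RatFunc ℝ) (S θs).row := by
      have h2 : (S θs).row = fun i => (LinearEquiv.funCongrLeft (RatFunc ℝ) (RatFunc ℝ) e)
          (fun q => if c i q then M.sysMat (α i q) i q else M.sysMat (β i q) i q) := by
        ext a b
        simp only [S, Matrix.row, Matrix.submatrix_apply, hglue, LinearEquiv.funCongrLeft_apply,
          LinearMap.funLeft_apply, dif_pos (And.intro a.2 (e b).2), Subtype.coe_eta]
        split_ifs <;> rfl
      rw [h2]
      exact hc.map' (LinearEquiv.funCongrLeft (RatFunc ℝ) (RatFunc ℝ) e).toLinearMap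
        (LinearEquiv.ker _)
    rw [Matrix.linearIndependent_rows_iff_isUnit, Matrix.isUnit_iff_isUnit_det] at hli
    exact hli.ne_zero
  have hfam : IsRationalFamily M.domain (fun θ => (S θ).det) :=
    IsRationalFamily.det fun a b => isRationalFamily_sysMat _ _
  filter_upwards [hfam.ae_ne_zero hθs hSs] with θ hθ hΘ u hu hker
  have hdet := hθ (hM.subset_domain hΘ)
  have hmul : (S θ).mulVec (fun a => u (e a)) = 0 := by
    ext a
    have := hker a a.2
    rw [← Finset.sum_subset (Finset.subset_univ Q) (fun v _ hv => by simp [hu v hv]),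
      ← Finset.sum_coe_sort, ← e.sum_comp] at this
    simpa [S, Matrix.mulVec, dotProduct] using this
  have hz := Matrix.eq_zero_of_mulVec_eq_zero hdet hmul
  ext v
  by_cases hv : v ∈ Q
  · have := congrFun hz (e.symm ⟨v, hv⟩)
    simpa using this
  · simp [hu v hv]

end ModelSet

/-! ### Values of transfer functions at infinity and at complex points -/

/-! ### Matrix algebra under a map that is a ring homomorphism only on a subring. -/

section PartialHom

variable {F K : Type*} [CommRing F] [CommRing K] {S : Subring F} (φ : S →+* K) {v : F → K}

theorem mul_apply_mem {l m k : Type*} [Fintype m] {A : Matrix l m F} {B : Matrix m k F}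
    (hA : ∀ i j, A i j ∈ S) (hB : ∀ i j, B i j ∈ S) (i : l) (j : k) : (A * B) i j ∈ S :=
  sum_mem fun x _ => mul_mem (hA i x) (hB x j)

/-- A map that is a ring homomorphism on a subring is multiplicative on matrices over it. -/
theorem map_mul_of_subring (hv : ∀ f (hf : f ∈ S), v f = φ ⟨f, hf⟩) {l m k : Type*} [Fintype m]
    {A : Matrix l m F} {B : Matrix m k F} (hA : ∀ i j, A i j ∈ S) (hB : ∀ i j, B i j ∈ S) :
    (A * B).map v = A.map v * B.map v := by
  ext i j
  simp only [Matrix.map_apply, Matrix.mul_apply]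
  have e : (∑ x, A i x * B x j) =
      ((∑ x, (⟨A i x, hA i x⟩ : S) * ⟨B x j, hB x j⟩ : S) : F) := by simp
  rw [hv _ (e ▸ Subtype.property _)]
  simp only [hv _ (hA i _), hv _ (hB _ j), ← map_mul, ← map_sum]
  congr 1
  exact Subtype.ext e

theorem det_mem_of_subring {m : Type*} [Fintype m] [DecidableEq m] {A : Matrix m m F}
    (hA : ∀ i j, A i j ∈ S) : A.det ∈ S := by
  rw [Matrix.det_apply']
  exact sum_mem fun σ _ => mul_mem (intCast_mem _ _) (prod_mem fun i _ => hA _ _)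

theorem map_det_of_subring (hv : ∀ f (hf : f ∈ S), v f = φ ⟨f, hf⟩) {m : Type*} [Fintype m]
    [DecidableEq m] {A : Matrix m m F} (hA : ∀ i j, A i j ∈ S) :
    v A.det = (A.map v).det := by
  let A' : Matrix m m S := fun i j => ⟨A i j, hA i j⟩
  have h1 : A.map v = φ.mapMatrix A' := by
    ext i j
    rw [Matrix.map_apply, hv _ (hA i j)]
    rfl
  have h2 : A.det = (A'.det : S) := by
    rw [← S.coe_subtype, RingHom.map_det]
    rfl
  rw [h1, ← RingHom.map_det, hv _ (det_mem_of_subring hA)]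
  congr 1
  exact Subtype.ext h2

theorem adjugate_mem_of_subring {m : Type*} [Fintype m] [DecidableEq m] {A : Matrix m m F}
    (hA : ∀ i j, A i j ∈ S) (i j : m) : A.adjugate i j ∈ S := by
  rw [Matrix.adjugate_apply]
  apply det_mem_of_subring
  intro a b
  by_cases h : a = j
  · subst h
    by_cases hb : b = i
    · subst hb; simp
    · simp [hb]
  · simpa [h] using hA a b

end PartialHom

/-- `IsProper` and `valInfty` refer to the reduced fraction with monic denominator. Comparing
degrees and top coefficients in the cross-multiplied identity allows them to be read off any
representation. -/
theorem ratFunc_div_proper {p q : ℝ[X]} (hq : q ≠ 0) (h : p.degree ≤ q.degree) :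
    IsProper (algebraMap ℝ[X] (RatFunc ℝ) p / algebraMap ℝ[X] (RatFunc ℝ) q) ∧
      valInfty (algebraMap ℝ[X] (RatFunc ℝ) p / algebraMap ℝ[X] (RatFunc ℝ) q) =
        p.coeff q.natDegree / q.leadingCoeff := by
  set f := algebraMap ℝ[X] (RatFunc ℝ) p / algebraMap ℝ[X] (RatFunc ℝ) q with hf
  have key : f.num * q = p * f.denom := (RatFunc.num_mul_eq_mul_denom_iff hq).2 hf
  have hproper : IsProper f := by
    have h1 : f.num.degree + q.degree ≤ f.denom.degree + q.degree := by
      rw [← degree_mul, key, degree_mul, add_comm]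
      exact add_le_add_right h _
    have hqd : q.degree ≠ ⊥ := by simpa [degree_eq_bot] using hq
    exact (WithBot.add_le_add_iff_right hqd).1 h1
  refine ⟨hproper, ?_⟩
  have h1 := congrArg (fun r => r.coeff (f.denom.natDegree + q.natDegree)) key
  rw [coeff_mul_add_eq_of_natDegree_le (natDegree_le_natDegree hproper) le_rfl, add_comm,
    coeff_mul_add_eq_of_natDegree_le (natDegree_le_natDegree h) le_rfl] at h1
  rw [eq_div_iff (leadingCoeff_ne_zero.2 hq)]
  have h2 : f.denom.coeff f.denom.natDegree = 1 := RatFunc.monic_denom f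
  rw [h2, mul_one] at h1
  exact h1

theorem isProper_C (c : ℝ) : IsProper (RatFunc.C c) := by
  simp only [IsProper, RatFunc.num_C, RatFunc.denom_C, degree_one]
  exact degree_C_le

theorem valInfty_C (c : ℝ) : valInfty (RatFunc.C c) = c := by
  simp [valInfty]

theorem proper_add {f g : RatFunc ℝ} (hf : IsProper f) (hg : IsProper g) :
    IsProper (f + g) ∧ valInfty (f + g) = valInfty f + valInfty g := by
  have hfd := f.denom_ne_zero
  have hgd := g.denom_ne_zero
  have e : f + g = algebraMap ℝ[X] (RatFunc ℝ) (f.num * g.denom + f.denom * g.num) /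
      algebraMap ℝ[X] (RatFunc ℝ) (f.denom * g.denom) := by
    conv_lhs => rw [← f.num_div_denom, ← g.num_div_denom]
    rw [div_add_div _ _ (RatFunc.algebraMap_ne_zero hfd) (RatFunc.algebraMap_ne_zero hgd)]
    simp
  have hdeg : (f.num * g.denom + f.denom * g.num).degree ≤ (f.denom * g.denom).degree := by
    refine (degree_add_le _ _).trans (max_le ?_ ?_)
    · rw [degree_mul, degree_mul]; exact add_le_add_left hf _
    · rw [degree_mul, degree_mul]; exact add_le_add_right hg _
  have := ratFunc_div_proper (mul_ne_zero hfd hgd) hdeg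
  rw [← e] at this
  refine ⟨this.1, ?_⟩
  rw [this.2, coeff_add, natDegree_mul hfd hgd, coeff_mul_add_eq_of_natDegree_le
    (natDegree_le_natDegree hf) le_rfl, coeff_mul_add_eq_of_natDegree_le le_rfl
    (natDegree_le_natDegree hg)]
  have h1 : f.denom.coeff f.denom.natDegree = 1 := RatFunc.monic_denom f
  have h2 : g.denom.coeff g.denom.natDegree = 1 := RatFunc.monic_denom g
  simp [valInfty, h1, h2, (RatFunc.monic_denom f).leadingCoeff, (RatFunc.monic_denom g).leadingCoeff]

theorem proper_mul {f g : RatFunc ℝ} (hf : IsProper f) (hg : IsProper g) :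
    IsProper (f * g) ∧ valInfty (f * g) = valInfty f * valInfty g := by
  have hfd := f.denom_ne_zero
  have hgd := g.denom_ne_zero
  have e : f * g = algebraMap ℝ[X] (RatFunc ℝ) (f.num * g.num) /
      algebraMap ℝ[X] (RatFunc ℝ) (f.denom * g.denom) := by
    conv_lhs => rw [← f.num_div_denom, ← g.num_div_denom]
    rw [div_mul_div_comm]
    simp
  have hdeg : (f.num * g.num).degree ≤ (f.denom * g.denom).degree := by
    rw [degree_mul, degree_mul]; exact add_le_add hf hg
  have := ratFunc_div_proper (mul_ne_zero hfd hgd) hdeg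
  rw [← e] at this
  refine ⟨this.1, ?_⟩
  rw [this.2, natDegree_mul hfd hgd, coeff_mul_add_eq_of_natDegree_le
    (natDegree_le_natDegree hf) (natDegree_le_natDegree hg)]
  simp [valInfty, (RatFunc.monic_denom f).leadingCoeff, (RatFunc.monic_denom g).leadingCoeff]

theorem proper_inv {f : RatFunc ℝ} (h0 : valInfty f ≠ 0) : IsProper f⁻¹ := by
  have hn : f.num ≠ 0 := fun h => h0 (by simp [valInfty, h])
  have hdeg : f.denom.degree ≤ f.num.degree := by
    rw [degree_eq_natDegree f.denom_ne_zero]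
    exact le_degree_of_ne_zero h0
  have := ratFunc_div_proper hn hdeg
  rw [← inv_div, RatFunc.num_div_denom] at this
  exact this.1

/-- The ring of proper transfer functions. -/
def properSubring : Subring (RatFunc ℝ) where
  carrier := {f | IsProper f}
  mul_mem' hf hg := (proper_mul hf hg).1
  one_mem' := by simpa using isProper_C 1
  add_mem' hf hg := (proper_add hf hg).1
  zero_mem' := by simpa using isProper_C 0
  neg_mem' := by
    intro f hf
    have := (proper_mul (isProper_C (-1)) hf).1
    simpa using this

/-- The value at infinity of proper transfer functions. -/
def valHom : properSubring →+* ℝ where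
  toFun f := valInfty f
  map_one' := by simpa using valInfty_C 1
  map_mul' f g := (proper_mul f.2 g.2).2
  map_zero' := by simpa using valInfty_C 0
  map_add' f g := (proper_add f.2 g.2).2

theorem valInfty_eq_valHom (f : RatFunc ℝ) (hf : f ∈ properSubring) :
    valInfty f = valHom ⟨f, hf⟩ := rfl

theorem valInfty_zero : valInfty 0 = 0 := map_zero valHom

theorem valInfty_one : valInfty 1 = 1 := map_one valHom

theorem map_valInfty_mul {l m k : Type*} [Fintype m] {A : Matrix l m (RatFunc ℝ)}
    {B : Matrix m k (RatFunc ℝ)} (hA : ∀ i j, IsProper (A i j)) (hB : ∀ i j, IsProper (B i j)) :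
    (A * B).map valInfty = A.map valInfty * B.map valInfty :=
  map_mul_of_subring valHom valInfty_eq_valHom hA hB

theorem isProper_mul_apply {l m k : Type*} [Fintype m] {A : Matrix l m (RatFunc ℝ)}
    {B : Matrix m k (RatFunc ℝ)} (hA : ∀ i j, IsProper (A i j)) (hB : ∀ i j, IsProper (B i j))
    (i : l) (j : k) : IsProper ((A * B) i j) :=
  mul_apply_mem (S := properSubring) hA hB i j

theorem map_valInfty_one {m : Type*} [DecidableEq m] :
    (1 : Matrix m m (RatFunc ℝ)).map valInfty = 1 :=
  Matrix.map_one _ valInfty_zero valInfty_one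

/-- Passes from well-posedness, a condition on real matrices at infinity, to invertibility over the
field of rational functions. -/
theorem det_ne_zero_of_valInfty {m : Type*} [Fintype m] [DecidableEq m]
    {A : Matrix m m (RatFunc ℝ)} (hA : ∀ i j, IsProper (A i j))
    (h : (A.map valInfty).det ≠ 0) : A.det ≠ 0 := by
  intro h0
  rw [← map_det_of_subring valHom valInfty_eq_valHom hA, h0] at h
  exact h valInfty_zero

theorem isProper_inv_apply {m : Type*} [Fintype m] [DecidableEq m]
    {A : Matrix m m (RatFunc ℝ)} (hA : ∀ i j, IsProper (A i j))
    (h : (A.map valInfty).det ≠ 0) (i j : m) : IsProper (A⁻¹ i j) := by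
  rw [← map_det_of_subring valHom valInfty_eq_valHom hA] at h
  rw [Matrix.inv_def, Ring.inverse_eq_inv, Matrix.smul_apply, smul_eq_mul]
  exact (proper_mul (proper_inv h) (adjugate_mem_of_subring (S := properSubring) hA i j)).1

theorem map_valInfty_inv {m : Type*} [Fintype m] [DecidableEq m]
    {A : Matrix m m (RatFunc ℝ)} (hA : ∀ i j, IsProper (A i j))
    (h : (A.map valInfty).det ≠ 0) : (A⁻¹).map valInfty = (A.map valInfty)⁻¹ := by
  symm
  apply Matrix.inv_eq_right_inv
  rw [← map_valInfty_mul hA (isProper_inv_apply hA h),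
    Matrix.mul_nonsing_inv _ (isUnit_iff_ne_zero.2 (det_ne_zero_of_valInfty hA h)),
    map_valInfty_one]

/-- The ring of the transfer functions without a pole in `Z`. -/
def regularSubring (Z : Set ℂ) : Subring (RatFunc ℝ) where
  carrier := {f | ∀ z ∈ Z, aeval z f.denom ≠ 0}
  mul_mem' {f g} hf hg z hz h := by
    have := aeval_eq_zero_of_dvd_aeval_eq_zero (RatFunc.denom_mul_dvd f g) h
    rw [map_mul] at this
    exact (mul_ne_zero (hf z hz) (hg z hz)) this
  one_mem' := by simp
  add_mem' {f g} hf hg z hz h := by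
    have := aeval_eq_zero_of_dvd_aeval_eq_zero (RatFunc.denom_add_dvd f g) h
    rw [map_mul] at this
    exact (mul_ne_zero (hf z hz) (hg z hz)) this
  zero_mem' := by simp
  neg_mem' {f} hf z hz h := by
    have h1 : (-f).denom ∣ f.denom := by
      have := RatFunc.denom_mul_dvd (RatFunc.C (-1)) f
      rw [RatFunc.denom_C, one_mul] at this
      simpa using this
    exact hf z hz (aeval_eq_zero_of_dvd_aeval_eq_zero h1 h)

theorem mem_regularSubring {Z : Set ℂ} {f : RatFunc ℝ} :
    f ∈ regularSubring Z ↔ ∀ z ∈ Z, aeval z f.denom ≠ 0 := Iff.rfl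

theorem regularSubring_anti {Z Z' : Set ℂ} (h : Z ⊆ Z') : regularSubring Z' ≤ regularSubring Z :=
  fun _ hf z hz => hf z (h hz)

theorem C_mem_regularSubring (Z : Set ℂ) (c : ℝ) : RatFunc.C c ∈ regularSubring Z := by
  simp [mem_regularSubring]

theorem mem_regularSubring_of_isStable {f : RatFunc ℝ} (hf : IsStable f) {Z : Set ℂ}
    (hZ : ∀ z ∈ Z, 1 ≤ ‖z‖) : f ∈ regularSubring Z :=
  fun z hz h => absurd (hf z h) (not_lt.2 (hZ z hz))

/-- Evaluation at a point of the transfer functions without a pole there. -/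
def evalHom (z : ℂ) : regularSubring {z} →+* ℂ where
  toFun f := evalAt z f
  map_one' := by simp [evalAt]
  map_mul' f g := RatFunc.eval_mul _ _ (f.2 z rfl) (g.2 z rfl)
  map_zero' := by simp [evalAt]
  map_add' f g := RatFunc.eval_add _ _ (f.2 z rfl) (g.2 z rfl)

theorem evalAt_eq_evalHom (z : ℂ) (f : RatFunc ℝ) (hf : f ∈ regularSubring {z}) :
    evalAt z f = evalHom z ⟨f, hf⟩ := rfl

theorem map_evalAt_mul {z : ℂ} {l m k : Type*} [Fintype m] {A : Matrix l m (RatFunc ℝ)}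
    {B : Matrix m k (RatFunc ℝ)} (hA : ∀ i j, A i j ∈ regularSubring {z})
    (hB : ∀ i j, B i j ∈ regularSubring {z}) :
    (A * B).map (evalAt z) = A.map (evalAt z) * B.map (evalAt z) :=
  map_mul_of_subring (evalHom z) (evalAt_eq_evalHom z) hA hB

theorem map_evalAt_one {z : ℂ} {m : Type*} [DecidableEq m] :
    (1 : Matrix m m (RatFunc ℝ)).map (evalAt z) = 1 :=
  Matrix.map_one _ (by simp [evalAt]) (by simp [evalAt])

/-! ### Disjoint paths and separation in directed graphs -/

/-- Vertex disjoint paths form a partial permutation: it moves along the edges of the paths, fixes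
the other vertices and returns the final vertices to the initial ones. -/
theorem exists_perm_of_disjoint_paths {V : Type} [DecidableEq V] {E : V → V → Prop} {A B : Set V}
    {k : ℕ} (P : Fin k → List V) (hP : ∀ s, IsPath E A B (P s))
    (hdisj : ∀ s t, s ≠ t → (P s).Disjoint (P t)) :
    ∃ (A' B' : Finset V) (π : Equiv.Perm V), (A' : Set V) ⊆ A ∧ (B' : Set V) ⊆ B ∧
      A'.card = k ∧ B'.card = k ∧ (∀ v ∈ B', π v ∈ A') ∧ ∀ v ∉ B', π v = v ∨ E v (π v) := by
  choose hchain hnodup hhead hlast using hP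
  choose h hA hh using hhead
  choose l hB hl using hlast
  have hmemh : ∀ s, h s ∈ P s := fun s => List.mem_of_head? (hh s)
  have hmeml : ∀ s, l s ∈ P s := fun s => List.mem_of_getLast? (hl s)
  have huniq : ∀ s t v, v ∈ P s → v ∈ P t → s = t := by
    intro s t v hs ht
    by_contra hne
    exact hdisj s t hne hs ht
  have hne : [] ∉ List.ofFn P := by
    intro hmem
    obtain ⟨s, hs⟩ := (List.mem_ofFn' _ _).1 hmem
    have := hmemh s
    simp [hs] at this
  set A' := Finset.univ.image h with hA'
  set B' := Finset.univ.image l with hB'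
  -- The paths are concatenated into a single list without repetitions, whose cyclic permutation is
  -- used: it follows each path and jumps from the end of one path to the start of the next, the
  -- last path returning to the first.
  set X := (List.ofFn P).flatten with hX
  have hmemX : ∀ v, v ∈ X ↔ ∃ s, v ∈ P s := by
    intro v
    simp [hX, List.mem_flatten, List.mem_ofFn', Set.mem_range]
  have hXn : X.Nodup := by
    rw [hX, List.nodup_flatten]
    refine ⟨?_, ?_⟩
    · intro p hp
      obtain ⟨s, rfl⟩ := (List.mem_ofFn' _ _).1 hp
      exact hnodup s
    · rw [List.pairwise_ofFn]
      exact fun s t hst => hdisj s t hst.ne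
  let R : V → V → Prop := fun u v => (u ∈ B' → v ∈ A') ∧ (u ∉ B' → E u v)
  have hXc : X.IsChain R := by
    rw [hX, List.isChain_flatten hne]
    refine ⟨?_, ?_⟩
    · intro p hp
      obtain ⟨s, rfl⟩ := (List.mem_ofFn' _ _).1 hp
      rw [List.isChain_iff_getElem]
      intro i hi
      have hE := List.isChain_iff_getElem.1 (hchain s) i hi
      refine ⟨fun hb => ?_, fun _ => hE⟩
      -- A vertex of `B'` on path s must be the last vertex of path s, so it has no successor there.
      exfalso
      obtain ⟨t, _, ht⟩ := Finset.mem_image.1 hb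
      obtain rfl := huniq s t _ (List.getElem_mem _) (ht ▸ hmeml t)
      have h1 := hl s
      rw [List.getLast?_eq_getElem?, List.getElem?_eq_getElem (by omega)] at h1
      have h2 : (P s)[(P s).length - 1] = (P s)[i] := by
        rw [← ht]; exact Option.some_injective _ h1
      have := (hnodup s).getElem_inj_iff.1 h2
      omega
    · apply List.Pairwise.isChain
      rw [List.pairwise_ofFn]
      intro s t _ x hx y hy
      rw [hl s] at hx
      rw [hh t] at hy
      obtain rfl : l s = x := by simpa using hx
      obtain rfl : h t = y := by simpa using hy
      exact ⟨fun _ => Finset.mem_image_of_mem _ (Finset.mem_univ _),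
        fun hx => absurd (Finset.mem_image_of_mem _ (Finset.mem_univ _)) hx⟩
  have hXlast : ∀ v, X.getLast? = some v → v ∈ B' := by
    intro v hv
    rw [hX, List.getLast?_flatten] at hv
    obtain ⟨p, hp, hpv⟩ := List.exists_of_findSome?_eq_some hv
    obtain ⟨s, rfl⟩ := (List.mem_ofFn' _ _).1 (List.mem_reverse.1 hp)
    rw [hl s] at hpv
    obtain rfl : l s = v := by simpa using hpv
    exact Finset.mem_image_of_mem _ (Finset.mem_univ _)
  have hXhead : ∀ v, X.head? = some v → v ∈ A' := by
    intro v hv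
    rw [hX, List.head?_flatten] at hv
    obtain ⟨p, hp, hpv⟩ := List.exists_of_findSome?_eq_some hv
    obtain ⟨s, rfl⟩ := (List.mem_ofFn' _ _).1 hp
    rw [hh s] at hpv
    obtain rfl : h s = v := by simpa using hpv
    exact Finset.mem_image_of_mem _ (Finset.mem_univ _)
  have hR : ∀ v ∈ X, R v (X.formPerm v) := by
    intro v hv
    obtain ⟨i, hi, rfl⟩ := List.getElem_of_mem hv
    rw [List.formPerm_apply_getElem X hXn i hi]
    rcases Nat.lt_or_ge (i + 1) X.length with hlt | hge
    · simp only [Nat.mod_eq_of_lt hlt]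
      exact List.isChain_iff_getElem.1 hXc i hlt
    · have hlen : i + 1 = X.length := by omega
      simp only [hlen, Nat.mod_self]
      have h1 : X[i] ∈ B' := hXlast _ (by
        rw [List.getLast?_eq_getElem?, List.getElem?_eq_getElem (by omega)]
        congr 2
        omega)
      have h2 : X[0] ∈ A' := hXhead _ (by
        rw [List.head?_eq_getElem?, List.getElem?_eq_getElem (by omega)])
      exact ⟨fun _ => h2, fun hn => absurd h1 hn⟩
  refine ⟨A', B', X.formPerm, ?_, ?_, ?_, ?_, ?_, ?_⟩
  · intro v hv
    obtain ⟨s, _, rfl⟩ := Finset.mem_image.1 hv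
    exact hA s
  · intro v hv
    obtain ⟨s, _, rfl⟩ := Finset.mem_image.1 hv
    exact hB s
  · rw [Finset.card_image_of_injective _ fun s t (hst : h s = h t) =>
      huniq s t _ (hmemh s) (hst ▸ hmemh t)]
    simp
  · rw [Finset.card_image_of_injective _ fun s t (hst : l s = l t) =>
      huniq s t _ (hmeml s) (hst ▸ hmeml t)]
    simp
  · intro v hv
    obtain ⟨s, _, rfl⟩ := Finset.mem_image.1 hv
    exact (hR _ ((hmemX _).2 ⟨s, hmeml s⟩)).1 hv
  · intro v hv
    by_cases hvX : v ∈ X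
    · exact Or.inr ((hR v hvX).2 hv)
    · exact Or.inl (List.formPerm_apply_of_notMem hvX)

/-- The maximum in the definition of `maxDisjointPaths` is attained. -/
theorem exists_disjoint_paths {V : Type} {E : V → V → Prop} {A B : Set V} {k : ℕ}
    (hk : maxDisjointPaths E A B = k) :
    ∃ P : Fin k → List V, (∀ s, IsPath E A B (P s)) ∧ ∀ s t, s ≠ t → (P s).Disjoint (P t) := by
  rcases Nat.eq_zero_or_pos k with rfl | hpos
  · exact ⟨fun s => s.elim0, fun s => s.elim0, fun s => s.elim0⟩
  · have hmem : maxDisjointPaths E A B ∈ {k : ℕ | ∃ P : Fin k → List V,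
        (∀ s, IsPath E A B (P s)) ∧ ∀ s t, s ≠ t → (P s).Disjoint (P t)} := by
      apply Nat.sSup_mem
      · exact ⟨0, fun s => s.elim0, fun s => s.elim0, fun s => s.elim0⟩
      · by_contra hb
        -- The supremum of an unbounded set of naturals is 0 by convention, which k > 0 excludes.
        rw [maxDisjointPaths, Nat.sSup_of_not_bddAbove hb] at hk
        omega
    rw [hk] at hmem
    exact hmem

/-- The side of the sources of a disconnecting set. -/
theorem IsDisconnecting.exists_closed {V : Type} {E : V → V → Prop} {A B D : Set V}
    (hD : IsDisconnecting E A B D) :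
    ∃ S : Set V, A ⊆ S ∪ D ∧ Disjoint S D ∧ Disjoint S B ∧
      ∀ v ∈ S, ∀ w, E v w → w ∈ S ∪ D := by
  -- The vertices reachable from `A` while avoiding `D`.
  refine ⟨{v | ∃ p, IsPath E A {v} p ∧ ∀ u ∈ p, u ∉ D}, ?_, ?_, ?_, ?_⟩
  · intro a ha
    by_cases hd : a ∈ D
    · exact Or.inr hd
    · exact Or.inl ⟨[a], ⟨by simp, by simp, ⟨a, ha, rfl⟩, ⟨a, rfl, rfl⟩⟩, by simpa using hd⟩
  · rw [Set.disjoint_left]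
    rintro v ⟨p, ⟨_, _, _, w, rfl, hw⟩, hp⟩
    exact hp _ (List.mem_of_getLast? hw)
  · rw [Set.disjoint_left]
    rintro v ⟨p, ⟨h1, h2, h3, w, rfl, hw⟩, hp⟩ hB
    obtain ⟨u, hu, huD⟩ := hD p ⟨h1, h2, h3, w, hB, hw⟩
    exact hp u hu huD
  · rintro v ⟨p, ⟨h1, h2, ⟨a, ha, hpa⟩, u, rfl, hu⟩, hp⟩ w hw
    by_cases hd : w ∈ D
    · exact Or.inr hd
    left
    -- If the new vertex is already on the path, appending it would repeat it; the path is cut there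
    -- instead.
    by_cases hwp : w ∈ p
    · obtain ⟨s, t, rfl⟩ := List.append_of_mem hwp
      have hpre : (s ++ [w]) <+: (s ++ w :: t) := ⟨t, by simp⟩
      refine ⟨s ++ [w], ⟨h1.prefix hpre, h2.sublist hpre.sublist, ⟨a, ha, ?_⟩, w, rfl, by simp⟩,
        fun u hu => hp u (hpre.subset hu)⟩
      rw [← hpa]
      cases s <;> simp
    · refine ⟨p ++ [w], ⟨?_, ?_, ⟨a, ha, ?_⟩, w, rfl, by simp⟩, ?_⟩
      · rw [List.isChain_append]
        refine ⟨h1, by simp, ?_⟩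
        intro x hx y hy
        rw [hu] at hx
        obtain rfl : u = x := by simpa using hx
        obtain rfl : w = y := by simpa using hy
        exact hw
      · rw [List.nodup_append]
        refine ⟨h2, by simp, ?_⟩
        intro x hx y hy
        obtain rfl : y = w := by simpa using hy
        rintro rfl
        exact hwp hx
      · rw [List.head?_append, hpa]
        rfl
      · intro x hx
        rcases List.mem_append.1 hx with hx | hx
        · exact hp x hx
        · obtain rfl : x = w := by simpa using hx
          exact hd

/-! ### The transfer matrix between all vertices -/

namespace ModelSet

variable {n L K : ℕ} (M : ModelSet n L K)

/-- The edge weights between all vertices. -/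
def extMat (θ : Fin n → ℝ) : Matrix M.Vertex M.Vertex (RatFunc ℝ) :=
  Matrix.fromBlocks (M.Gmat θ) (M.Xmat θ) 0 0

/-- The transfer matrix between all vertices. -/
def Text (θ : Fin n → ℝ) : Matrix M.Vertex M.Vertex (RatFunc ℝ) :=
  Matrix.fromBlocks (M.T θ) (M.T θ * M.Xmat θ) 0 1

variable {M}

theorem extMat_inl (θ : Fin n → ℝ) (a : Fin L) (v : M.Vertex) :
    M.extMat θ (Sum.inl a) v = M.edgeMat θ a v := by
  cases v <;> rfl

theorem extMat_inr (θ : Fin n → ℝ) (x : M.Ext) (v : M.Vertex) :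
    M.extMat θ (Sum.inr x) v = 0 := by
  cases v <;> rfl

theorem edge_of_extMat_ne_zero {θ : Fin n → ℝ} (hθ : θ ∈ M.Θ) {u v : M.Vertex}
    (h : M.extMat θ u v ≠ 0) : M.Edge v u := by
  rcases u with a | x
  · exact ⟨a, rfl, fun h0 => h (by rw [extMat_inl, h0 θ hθ])⟩
  · exact absurd (extMat_inr θ x v) h

theorem isProper_one_apply {m : Type*} [DecidableEq m] (a b : m) :
    IsProper ((1 : Matrix m m (RatFunc ℝ)) a b) := by
  by_cases h : a = b
  · rw [h, Matrix.one_apply_eq]; exact one_mem properSubring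
  · rw [Matrix.one_apply_ne h]; exact zero_mem properSubring

theorem IsValid.isProper_one_sub_G (hM : M.IsValid) {θ : Fin n → ℝ} (hθ : θ ∈ M.Θ) (a b : Fin L) :
    IsProper ((1 - M.Gmat θ) a b) :=
  properSubring.sub_mem (isProper_one_apply a b) (hM.proper_G θ hθ a b)

theorem IsValid.map_valInfty_one_sub_G (hM : M.IsValid) {θ : Fin n → ℝ} (hθ : θ ∈ M.Θ) :
    (1 - M.Gmat θ).map valInfty = 1 - M.Ginfty θ := by
  ext a b
  have h2 := map_sub valHom ⟨_, isProper_one_apply a b⟩ ⟨_, hM.proper_G θ hθ a b⟩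
  have h3 : valInfty ((1 : Matrix (Fin L) (Fin L) (RatFunc ℝ)) a b) =
      (1 : Matrix (Fin L) (Fin L) ℝ) a b := congrFun (congrFun map_valInfty_one a) b
  exact h2.trans (congrArg (· - _) h3)

theorem IsValid.det_submatrix_one_sub_G_ne_zero (hM : M.IsValid) {θ : Fin n → ℝ} (hθ : θ ∈ M.Θ)
    (S : Finset (Fin L)) : ((1 - M.Gmat θ).submatrix (fun a : S => (a : Fin L))
      (fun a : S => (a : Fin L))).det ≠ 0 := by
  apply det_ne_zero_of_valInfty
  · intro a b
    exact hM.isProper_one_sub_G hθ _ _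
  · have := hM.wellPosed θ hθ S
    rwa [← hM.map_valInfty_one_sub_G hθ] at this

theorem IsValid.det_one_sub_Ginfty_ne_zero (hM : M.IsValid) {θ : Fin n → ℝ} (hθ : θ ∈ M.Θ) :
    (1 - M.Ginfty θ).det ≠ 0 := by
  have := hM.wellPosed θ hθ Finset.univ
  have e := Matrix.det_submatrix_equiv_self
    (Equiv.subtypeUnivEquiv (p := fun a => a ∈ (Finset.univ : Finset (Fin L)))
      (fun a => Finset.mem_univ a)) (1 - M.Ginfty θ)
  rw [← e]
  exact this

theorem IsValid.isUnit_det_one_sub_G (hM : M.IsValid) {θ : Fin n → ℝ} (hθ : θ ∈ M.Θ) :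
    IsUnit (1 - M.Gmat θ).det := by
  rw [isUnit_iff_ne_zero]
  apply det_ne_zero_of_valInfty (hM.isProper_one_sub_G hθ)
  rw [hM.map_valInfty_one_sub_G hθ]
  exact hM.det_one_sub_Ginfty_ne_zero hθ

theorem one_sub_extMat (θ : Fin n → ℝ) :
    1 - M.extMat θ = Matrix.fromBlocks (1 - M.Gmat θ) (-M.Xmat θ) 0 1 := by
  rw [extMat, ← Matrix.fromBlocks_one, sub_eq_add_neg, Matrix.fromBlocks_neg,
    Matrix.fromBlocks_add]
  simp [sub_eq_add_neg]

theorem IsValid.Text_mul (hM : M.IsValid) {θ : Fin n → ℝ} (hθ : θ ∈ M.Θ) :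
    M.Text θ * (1 - M.extMat θ) = 1 := by
  rw [one_sub_extMat, Text, Matrix.fromBlocks_multiply]
  simp [T, Matrix.nonsing_inv_mul _ (hM.isUnit_det_one_sub_G hθ)]

theorem IsValid.mul_Text (hM : M.IsValid) {θ : Fin n → ℝ} (hθ : θ ∈ M.Θ) :
    (1 - M.extMat θ) * M.Text θ = 1 :=
  mul_eq_one_comm.1 (hM.Text_mul hθ)

theorem IsValid.Text_eq (hM : M.IsValid) {θ : Fin n → ℝ} (hθ : θ ∈ M.Θ) (r v : M.Vertex) :
    M.Text θ r v = (if r = v then 1 else 0) + ∑ u, M.Text θ r u * M.extMat θ u v := by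
  have := congrFun (congrFun (hM.Text_mul hθ) r) v
  rw [mul_sub, mul_one, Matrix.sub_apply, Matrix.mul_apply, Matrix.one_apply] at this
  rw [← this]
  ring

/-- Vertex disjoint paths give a generically nonsingular square submatrix of the transfer matrix
between all vertices. -/
theorem ae_Text_injective (hM : M.IsValid) (hindep : M.IndependentlyParameterized)
    (hfixed : M.FixedEntriesRegular) {A B : Set M.Vertex} {k : ℕ} (hk : M.b A B = k) :
    ∃ A' B' : Finset M.Vertex, (A' : Set M.Vertex) ⊆ A ∧ (B' : Set M.Vertex) ⊆ B ∧
      A'.card = k ∧ B'.card = k ∧ ∀ᵐ θ : Fin n → ℝ, θ ∈ M.Θ → ∀ c : M.Vertex → RatFunc ℝ,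
        (∀ v ∉ A', c v = 0) → (∀ r ∈ B', ∑ v, M.Text θ r v * c v = 0) → c = 0 := by
  classical
  obtain ⟨P, hP, hdisj⟩ := exists_disjoint_paths hk
  obtain ⟨A', B', π, hA, hB, hAk, hBk, hπB, hπE⟩ := exists_perm_of_disjoint_paths P hP hdisj
  have himg : B'.image π = A' := by
    apply Finset.eq_of_subset_of_card_le
    · intro v hv
      obtain ⟨w, hw, rfl⟩ := Finset.mem_image.1 hv
      exact hπB w hw
    · rw [Finset.card_image_of_injective _ π.injective, hAk, hBk]
  have hπA : ∀ v, π v ∈ A' → v ∈ B' := by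
    intro v hv
    rw [← himg] at hv
    obtain ⟨w, hw, hwv⟩ := Finset.mem_image.1 hv
    exact π.injective hwv ▸ hw
  have hedge : ∀ w, w ∉ A' → π.symm w = w ∨ M.Edge (π.symm w) w := by
    intro w hw
    have hb : π.symm w ∉ B' := fun h => hw (by simpa using hπB _ h)
    rcases hπE _ hb with h | h
    · left; simpa using h.symm
    · right; simpa using h
  -- The complementary minor: rows are the internal vertices outside `A'`, and the inverse
  -- permutation matches each one to itself or to its predecessor on a path.
  set R : Finset (Fin L) := Finset.univ.filter (fun a => (Sum.inl a : M.Vertex) ∉ A') with hR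
  set σ : Fin L → M.Vertex := fun a => π.symm (Sum.inl a) with hσ
  have hσi : Function.Injective σ := π.symm.injective.comp Sum.inl_injective
  refine ⟨A', B', hA, hB, hAk, hBk, ?_⟩
  have hae := ae_submatrix_injective hM hindep hfixed R (R.image σ)
    (Finset.card_image_of_injective _ hσi) σ hσi.injOn
    (fun a ha => Finset.mem_image_of_mem _ ha)
    (fun a ha => hedge _ (Finset.mem_filter.1 ha).2)
  filter_upwards [hae] with θ hθ hΘ c hc hcB
  set u : M.Vertex → RatFunc ℝ := (M.Text θ).mulVec c with hu
  have hcu : (1 - M.extMat θ).mulVec u = c := by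
    rw [hu, Matrix.mulVec_mulVec, hM.mul_Text hΘ, Matrix.one_mulVec]
  have hcu' : ∀ v, u v - ∑ w, M.extMat θ v w * u w = c v := by
    intro v
    rw [← congrFun hcu v, Matrix.sub_mulVec, Matrix.one_mulVec]
    rfl
  -- The vector `u` vanishes on `B'` by assumption. It also vanishes at external vertices outside
  -- `A'`, because nothing enters them and `c` is zero there. So `u` is supported on the columns of
  -- the complementary minor, whose rows annihilate it.
  have hu0 : u = 0 := by
    apply hθ hΘ
    · intro v hv
      by_cases hπ : π v ∈ A'
      · exact hcB v (hπA v hπ)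
      · rcases hw : π v with a | x
        · exfalso
          apply hv
          refine Finset.mem_image.2 ⟨a, ?_, ?_⟩
          · simp only [hR, Finset.mem_filter, Finset.mem_univ, true_and]
            rwa [← hw]
          · simp [hσ, ← hw]
        · have hvx : v = Sum.inr x := by
            rcases hedge _ hπ with h | ⟨k, hk, _⟩
            · rw [← hw, ← h, Equiv.symm_apply_apply]
            · rw [hw] at hk; cases hk
          have h1 := hcu' v
          rw [hvx] at h1
          simp only [extMat_inr, zero_mul, Finset.sum_const_zero, sub_zero] at h1
          rw [hvx, h1]
          apply hc
          rwa [← hw]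
    · intro a ha
      have h1 := hcu' (Sum.inl a)
      rw [hc _ (Finset.mem_filter.1 ha).2] at h1
      simp only [sysMat_eq, sub_mul, Finset.sum_sub_distrib, ite_mul, one_mul, zero_mul,
        Finset.sum_ite_eq', Finset.mem_univ, if_true]
      simp only [extMat_inl] at h1
      rw [← neg_eq_zero, neg_sub, h1]
  rw [← hcu, hu0, Matrix.mulVec_zero]

/-- On the rows outside the source side of a disconnecting set `D`, the columns of the transfer
matrix of the source side are combinations of the columns of `D`. -/
theorem IsValid.Text_mem_span (hM : M.IsValid) {θ : Fin n → ℝ} (hθ : θ ∈ M.Θ)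
    {S D : Set M.Vertex} (hS : ∀ v ∈ S, ∀ w, M.Edge v w → w ∈ S ∪ D) (v : M.Vertex)
    (hv : v ∈ S ∪ D) :
    (fun r : {r // r ∉ S} => M.Text θ r v) ∈
      Submodule.span (RatFunc ℝ) ((fun d (r : {r // r ∉ S}) => M.Text θ r d) '' D) := by
  classical
  set Y := Submodule.span (RatFunc ℝ) ((fun d (r : {r // r ∉ S}) => M.Text θ r d) '' D) with hY
  let p : M.Vertex → ({r // r ∉ S} → RatFunc ℝ) := fun v r => M.Text θ r v
  change p v ∈ Y
  have hpD : ∀ d ∈ D, p d ∈ Y := fun d hd => Submodule.subset_span ⟨d, hd, rfl⟩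
  -- Restricting to rows outside `S` removes the unit vector from the column identity.
  have hp : ∀ v ∈ S, p v = ∑ u, M.extMat θ u v • p u := by
    intro v hv
    ext r
    have hne : (r : M.Vertex) ≠ v := fun h => r.2 (h ▸ hv)
    simp only [p, Finset.sum_apply, Pi.smul_apply, smul_eq_mul]
    rw [hM.Text_eq hθ, if_neg hne, zero_add]
    exact Finset.sum_congr rfl fun _ _ => mul_comm _ _
  have hext : ∀ v ∈ S, ∀ u, u ∉ S → M.extMat θ u v • p u ∈ Y := by
    intro v hv u hu
    by_cases h0 : M.extMat θ u v = 0
    · rw [h0, zero_smul]; exact zero_mem _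
    · have := (hS v hv u (edge_of_extMat_ne_zero hθ h0)).resolve_left hu
      exact Submodule.smul_mem _ _ (hpD u this)
  -- The column identities at the internal vertices of `S` form a linear system whose matrix is a
  -- principal block of I − G, invertible by well-posedness. External vertices of `S` need no
  -- inversion, since they have no incoming edges.
  let I : Finset (Fin L) := Finset.univ.filter fun a => Sum.inl a ∈ S
  have hI : ∀ a, a ∈ I ↔ (Sum.inl a : M.Vertex) ∈ S := by simp [I]
  let Q := (1 - M.Gmat θ).submatrix (fun a : I => (a : Fin L)) (fun a : I => (a : Fin L))
  have hQ : IsUnit Q.det := isUnit_iff_ne_zero.2 (hM.det_submatrix_one_sub_G_ne_zero hθ I)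
  have hq : ∀ b : I, ∑ a : I, Q a b • p (Sum.inl a) ∈ Y := by
    intro b
    have hb := (hI b).1 b.2
    have h1 : ∑ a : I, Q a b • p (Sum.inl a) =
        ∑ a ∈ Finset.univ.filter (fun a => a ∉ I), M.Gmat θ a b • p (Sum.inl a) := by
      have h2 := hp _ hb
      rw [Fintype.sum_sum_type] at h2
      simp only [extMat_inr, zero_smul, Finset.sum_const_zero, add_zero, extMat_inl, edgeMat,
        Matrix.fromCols_apply_inl] at h2
      rw [← Finset.sum_filter_add_sum_filter_not _ (fun a => a ∈ I)] at h2
      have h3 : ∑ a : I, Q a b • p (Sum.inl a) = p (Sum.inl b) -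
          ∑ a ∈ Finset.univ.filter (fun a => a ∈ I), M.Gmat θ a b • p (Sum.inl a) := by
        have h4 : Finset.univ.filter (fun a => a ∈ I) = I := by ext; simp
        rw [h4, ← Finset.sum_coe_sort I (fun a => M.Gmat θ a b • p (Sum.inl a))]
        simp only [Q, Matrix.submatrix_apply, Matrix.sub_apply, sub_smul, Finset.sum_sub_distrib]
        congr 1
        rw [Finset.sum_eq_single b]
        · rw [Matrix.one_apply_eq, one_smul]
        · intro a _ hab
          rw [Matrix.one_apply_ne fun h => hab (Subtype.ext h), zero_smul]
        · exact fun h => absurd (Finset.mem_univ _) h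
      rw [h3]
      nth_rewrite 1 [h2]
      abel
    rw [h1]
    refine Submodule.sum_mem _ fun a ha => ?_
    have hna : (Sum.inl a : M.Vertex) ∉ S := fun h =>
      (Finset.mem_filter.1 ha).2 ((hI a).2 h)
    exact hext _ hb _ hna
  have hinternal : ∀ c : I, p (Sum.inl c) ∈ Y := by
    intro c
    have : p (Sum.inl c) = ∑ b : I, Q⁻¹ b c • ∑ a : I, Q a b • p (Sum.inl a) := by
      simp only [Finset.smul_sum]
      rw [Finset.sum_comm]
      have h1 : ∀ a : I, ∑ b : I, Q⁻¹ b c • Q a b • p (Sum.inl a) =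
          (1 : Matrix I I (RatFunc ℝ)) a c • p (Sum.inl a) := by
        intro a
        rw [← Matrix.mul_nonsing_inv Q hQ, Matrix.mul_apply, Finset.sum_smul]
        exact Finset.sum_congr rfl fun b _ => by rw [smul_smul, mul_comm]
      rw [Finset.sum_congr rfl fun a _ => h1 a, Finset.sum_eq_single c]
      · rw [Matrix.one_apply_eq, one_smul]
      · intro a _ hac
        rw [Matrix.one_apply_ne hac, zero_smul]
      · exact fun h => absurd (Finset.mem_univ _) h
    rw [this]
    exact Submodule.sum_mem _ fun b _ => Submodule.smul_mem _ _ (hq b)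
  rcases hv with hv | hv
  · rw [hp v hv]
    refine Submodule.sum_mem _ fun u _ => ?_
    by_cases hu : u ∈ S
    · rcases u with a | x
      · exact Submodule.smul_mem _ _ (hinternal ⟨a, (hI a).2 hu⟩)
      · rw [extMat_inr, zero_smul]; exact zero_mem _
    · exact hext v hv u hu
  · exact hpD v hv

end ModelSet

/-! ### Uniqueness of spectral factors -/

theorem evalAt_eq (z : ℂ) (f : RatFunc ℝ) : evalAt z f = aeval z f.num / aeval z f.denom := rfl

theorem evalAt_C (z : ℂ) (c : ℝ) : evalAt z (RatFunc.C c) = c := by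
  simp [evalAt]

theorem isStable_iff {f : RatFunc ℝ} : IsStable f ↔ f ∈ regularSubring {z | 1 ≤ ‖z‖} :=
  ⟨fun h _ hz h0 => absurd (h _ h0) (not_lt.2 hz),
    fun h z h0 => lt_of_not_ge fun hz => h z hz h0⟩

theorem finite_poles (f : RatFunc ℝ) : {z : ℂ | aeval z f.denom = 0}.Finite := by
  have h0 : f.denom.map (algebraMap ℝ ℂ) ≠ 0 :=
    (Polynomial.map_ne_zero_iff (algebraMap ℝ ℂ).injective).2 f.denom_ne_zero
  refine (Polynomial.finite_setOfPred_isRoot h0).subset fun z hz => ?_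
  have hz' : aeval z f.denom = 0 := hz
  change (f.denom.map (algebraMap ℝ ℂ)).IsRoot z
  rwa [Polynomial.IsRoot, Polynomial.eval_map, ← Polynomial.aeval_def]

theorem num_ne_zero_of_denom_eq_zero {f : RatFunc ℝ} {z : ℂ} (h : aeval z f.denom = 0) :
    aeval z f.num ≠ 0 := by
  intro hn
  obtain ⟨a, b, hab⟩ := f.isCoprime_num_denom
  have := congrArg (aeval z) hab
  simp [h, hn] at this

theorem isPreconnected_unitCircle : IsPreconnected (Metric.sphere (0 : ℂ) 1) :=
  isPreconnected_sphere (by rw [Complex.rank_real_complex]; norm_num) 0 1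

theorem unitCircle_nontrivial : (Metric.sphere (0 : ℂ) 1).Nontrivial :=
  ⟨1, by simp, -1, by simp, by norm_num⟩

/-- The circle has no isolated points, so deleting finitely many points leaves a dense subset. -/
theorem mem_closure_unitCircle_diff {Z : Set ℂ} (hZ : Z.Finite) {z : ℂ} (hz : ‖z‖ = 1) :
    z ∈ closure (Metric.sphere (0 : ℂ) 1 \ Z) := by
  have hacc : AccPt z (Filter.principal (Metric.sphere (0 : ℂ) 1)) :=
    isPreconnected_unitCircle.preperfect_of_nontrivial unitCircle_nontrivial z (by simpa using hz)
  rw [accPt_iff_frequently_nhdsNE] at hacc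
  rw [mem_closure_iff_frequently]
  have hev : ∀ᶠ w in nhdsWithin z {z}ᶜ, w ∉ Z := by
    have : (Z \ {z})ᶜ ∈ nhds z :=
      (hZ.subset Set.sdiff_subset).isClosed.compl_mem_nhds (by simp)
    filter_upwards [mem_nhdsWithin_of_mem_nhds this, self_mem_nhdsWithin] with w h1 h2 hw
    exact h1 ⟨hw, h2⟩
  refine Filter.Frequently.filter_mono ?_ (nhdsWithin_le_nhds (s := {z}ᶜ))
  exact (hacc.and_eventually hev).mono fun w hw => ⟨hw.1, hw.2⟩

/-- A transfer function that is bounded on the unit circle has no pole there. -/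
theorem denom_ne_zero_of_bounded {f : RatFunc ℝ} {Z : Set ℂ} (hZ : Z.Finite)
    (h : ∀ z : ℂ, ‖z‖ = 1 → z ∉ Z → ‖evalAt z f‖ ≤ 1) {z : ℂ} (hz : ‖z‖ = 1) :
    aeval z f.denom ≠ 0 := by
  intro h0
  -- Written without division, the bound is a closed condition and extends to the deleted points. At
  -- a pole it would make numerator and denominator vanish together, against coprimality.
  have hclosed : IsClosed {w : ℂ | ‖aeval w f.num‖ ≤ ‖aeval w f.denom‖} :=
    isClosed_le (f.num.continuous_aeval).norm (f.denom.continuous_aeval).norm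
  have hsub : Metric.sphere (0 : ℂ) 1 \ (Z ∪ {z | aeval z f.denom = 0}) ⊆
      {w : ℂ | ‖aeval w f.num‖ ≤ ‖aeval w f.denom‖} := by
    rintro w ⟨hw, hwZ⟩
    simp only [Set.mem_union, not_or] at hwZ
    have h1 := h w (by simpa using hw) hwZ.1
    have hne : aeval w f.denom ≠ 0 := hwZ.2
    rw [evalAt_eq, norm_div, div_le_one (norm_pos_iff.2 hne)] at h1
    exact h1
  have := closure_minimal hsub hclosed
    (mem_closure_unitCircle_diff (hZ.union (finite_poles f)) hz)
  have hle : ‖aeval z f.num‖ ≤ ‖aeval z f.denom‖ := this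
  rw [h0, norm_zero] at hle
  exact num_ne_zero_of_denom_eq_zero h0 (norm_le_zero_iff.1 hle)

theorem aeval_reflect {z : ℂ} (hz : z ≠ 0) {N : ℕ} {p : ℝ[X]} (hp : p.natDegree ≤ N) :
    aeval z (reflect N p) = z ^ N * aeval z⁻¹ p := by
  let _ : Invertible z⁻¹ := invertibleOfNonzero (inv_ne_zero hz)
  have := eval₂_reflect_mul_pow (algebraMap ℝ ℂ) z⁻¹ N p hp
  rw [invOf_eq_inv, inv_inv] at this
  rw [aeval_def, aeval_def, ← this, mul_comm, mul_assoc, ← mul_pow, inv_mul_cancel₀ hz, one_pow,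
    mul_one]

/-- A stable proper transfer function that coincides on the unit circle with the conjugate of another
one is constant. -/
theorem eq_C_of_conj_eq {f g : RatFunc ℝ} (hf : IsStable f) (hfp : IsProper f) (hg : IsStable g)
    (hgp : IsProper g) {Z : Set ℂ} (hZ : Z.Finite)
    (h : ∀ z : ℂ, ‖z‖ = 1 → z ∉ Z → evalAt z f = (starRingEnd ℂ) (evalAt z g)) :
    ∃ c, f = RatFunc.C c := by
  set N := g.denom.natDegree with hN
  have hgN : g.num.natDegree ≤ N := natDegree_le_natDegree hgp
  -- On the circle conj z = 1/z, so f(z) = g(1/z) at infinitely many points; multiplying by z^N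
  -- gives a polynomial identity.
  have key : f.num * reflect N g.denom = reflect N g.num * f.denom := by
    apply Polynomial.map_injective _ (algebraMap ℝ ℂ).injective
    apply Polynomial.eq_of_infinite_eval_eq
    refine Set.Infinite.mono (s := Metric.sphere (0 : ℂ) 1 \ Z) ?_
      ((isPreconnected_unitCircle.infinite_of_nontrivial unitCircle_nontrivial).sdiff hZ)
    rintro z ⟨hz, hzZ⟩
    have hz1 : ‖z‖ = 1 := by simpa using hz
    have hz0 : z ≠ 0 := by
      rintro rfl
      simp at hz1
    have hconj : (starRingEnd ℂ) z = z⁻¹ := by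
      rw [Complex.inv_def, Complex.normSq_eq_norm_sq, hz1]
      simp
    have h1 := h z hz1 hzZ
    have hfd : aeval z f.denom ≠ 0 := isStable_iff.1 hf z hz1.ge
    have hgd : aeval z⁻¹ g.denom ≠ 0 := isStable_iff.1 hg z⁻¹ (by simp [hz1])
    rw [evalAt_eq, evalAt_eq, map_div₀, ← aeval_conj, ← aeval_conj, hconj,
      div_eq_div_iff hfd hgd] at h1
    change eval z _ = eval z _
    rw [Polynomial.eval_map, Polynomial.eval_map, ← aeval_def, ← aeval_def, map_mul, map_mul,
      aeval_reflect hz0 le_rfl, aeval_reflect hz0 hgN]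
    linear_combination z ^ N * h1
  have hdvd : f.denom ∣ reflect N g.denom :=
    f.isCoprime_num_denom.symm.dvd_of_dvd_mul_left (key ▸ Dvd.intro_left _ rfl)
  -- A pole z of f lies inside the disc and 1/z is a pole of g, also inside the disc, which is
  -- impossible. The point z = 0 is excluded because the reflected monic denominator has value 1
  -- there. Without poles, f is a proper polynomial.
  have hdeg : f.denom.natDegree = 0 := by
    by_contra hne
    obtain ⟨z, hz⟩ := Complex.exists_root (f := f.denom.map (algebraMap ℝ ℂ)) (by
      rw [degree_map]
      exact natDegree_pos_iff_degree_pos.1 (Nat.pos_of_ne_zero hne))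
    rw [IsRoot, eval_map, ← aeval_def] at hz
    have hlt := hf z hz
    have hr := aeval_eq_zero_of_dvd_aeval_eq_zero hdvd hz
    have hz0 : z ≠ 0 := by
      rintro rfl
      have hc := coeff_zero_reverse g.denom
      rw [(RatFunc.monic_denom g).leadingCoeff, reverse, coeff_zero_eq_aeval_zero] at hc
      have h2 : (aeval (0 : ℂ)) (reflect N g.denom) =
          algebraMap ℝ ℂ (aeval (0 : ℝ) (reflect N g.denom)) := by
        rw [← aeval_algebraMap_apply, map_zero]
      rw [h2, hc] at hr
      simp at hr
    rw [aeval_reflect hz0 le_rfl] at hr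
    have hr' := (mul_eq_zero.1 hr).resolve_left (pow_ne_zero _ hz0)
    have hlt' := hg _ hr'
    rw [norm_inv] at hlt'
    have := one_lt_inv_iff₀.2 ⟨norm_pos_iff.2 hz0, hlt⟩
    linarith
  refine (RatFunc.eq_C_iff f).2 ⟨?_, hdeg⟩
  have := natDegree_le_natDegree hfp
  omega

section Factors

variable {m : Type} [Fintype m] [DecidableEq m]

/-- The minimum phase condition still allows the inverse `J` to have poles on the circle. Unitarity
of the quotient off these poles bounds its entries by 1, so the poles cancel in the product. -/
theorem quotient_unitary {E₀ E₁ J : Matrix m m (RatFunc ℝ)} (h₀ : ∀ i j, IsStable (E₀ i j))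
    (h₁ : ∀ i j, IsStable (E₁ i j)) (hJ : ∀ i j, J i j ∈ regularSubring {z | 1 < ‖z‖})
    (hinv : J * E₁ = 1)
    (h : ∀ z : ℂ, ‖z‖ = 1 → E₀.map (evalAt z) * (E₀.map (evalAt z)).conjTranspose =
      E₁.map (evalAt z) * (E₁.map (evalAt z)).conjTranspose) :
    (∀ i j, IsStable ((J * E₀) i j)) ∧ ∃ Z : Set ℂ, Z.Finite ∧ ∀ z : ℂ, ‖z‖ = 1 → z ∉ Z →
      (J * E₀).map (evalAt z) * ((J * E₀).map (evalAt z)).conjTranspose = 1 := by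
  set Z : Set ℂ := ⋃ i, ⋃ j, {z : ℂ | aeval z (J i j).denom = 0} with hZ
  have hZfin : Z.Finite := Set.finite_iUnion fun i => Set.finite_iUnion fun j => finite_poles _
  have hunit : ∀ z : ℂ, ‖z‖ = 1 → z ∉ Z →
      (J * E₀).map (evalAt z) * ((J * E₀).map (evalAt z)).conjTranspose = 1 := by
    intro z hz hzZ
    have hJz : ∀ i j, J i j ∈ regularSubring {z} := by
      rintro i j w rfl h0
      exact hzZ (Set.mem_iUnion.2 ⟨i, Set.mem_iUnion.2 ⟨j, h0⟩⟩)
    have hz' : ({z} : Set ℂ) ⊆ {z | 1 ≤ ‖z‖} := by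
      rintro w rfl
      exact hz.ge
    have h₀z : ∀ i j, E₀ i j ∈ regularSubring {z} := fun i j =>
      regularSubring_anti hz' (isStable_iff.1 (h₀ i j))
    have h₁z : ∀ i j, E₁ i j ∈ regularSubring {z} := fun i j =>
      regularSubring_anti hz' (isStable_iff.1 (h₁ i j))
    have h1 : J.map (evalAt z) * E₁.map (evalAt z) = 1 := by
      rw [← map_evalAt_mul hJz h₁z, hinv, map_evalAt_one]
    rw [map_evalAt_mul hJz h₀z, Matrix.conjTranspose_mul]
    calc J.map (evalAt z) * E₀.map (evalAt z) *
          ((E₀.map (evalAt z)).conjTranspose * (J.map (evalAt z)).conjTranspose)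
        = J.map (evalAt z) * (E₀.map (evalAt z) * (E₀.map (evalAt z)).conjTranspose) *
          (J.map (evalAt z)).conjTranspose := by simp only [Matrix.mul_assoc]
      _ = (J.map (evalAt z) * E₁.map (evalAt z)) *
          (J.map (evalAt z) * E₁.map (evalAt z)).conjTranspose := by
          rw [h z hz, Matrix.conjTranspose_mul]; simp only [Matrix.mul_assoc]
      _ = 1 := by rw [h1]; simp
  refine ⟨fun i j => isStable_iff.2 fun z hz => ?_, Z, hZfin, hunit⟩
  rcases eq_or_lt_of_le (show 1 ≤ ‖z‖ from hz) with heq | hlt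
  · refine denom_ne_zero_of_bounded hZfin (fun w hw hwZ => ?_) heq.symm
    have h1 := congrFun (congrFun (hunit w hw hwZ) i) i
    simp only [Matrix.mul_apply (M := (J * E₀).map (evalAt w)), Matrix.conjTranspose_apply,
      Matrix.map_apply, Matrix.one_apply_eq, RCLike.star_def, Complex.mul_conj] at h1
    have h2 : ∑ k, Complex.normSq (evalAt w ((J * E₀) i k)) = 1 := by exact_mod_cast h1
    have h3 := Finset.single_le_sum (f := fun k => Complex.normSq (evalAt w ((J * E₀) i k)))
      (fun k _ => Complex.normSq_nonneg _) (Finset.mem_univ j)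
    rw [h2] at h3
    simp only [Complex.normSq_eq_norm_sq] at h3
    nlinarith [norm_nonneg (evalAt w ((J * E₀) i j))]
  · have hlt' : ({z | 1 < ‖z‖} : Set ℂ) ⊆ {z | 1 ≤ ‖z‖} := fun w (hw : 1 < ‖w‖) => hw.le
    exact mul_apply_mem (S := regularSubring {z | 1 < ‖z‖}) hJ
      (fun i j => regularSubring_anti hlt' (isStable_iff.1 (h₀ i j))) i j z hlt

open scoped MatrixOrder in
theorem exists_eq_mul_transpose {Λ : Matrix m m ℝ} (h : Λ.PosSemidef) :
    ∃ B : Matrix m m ℝ, Λ = B * B.transpose := by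
  refine ⟨CFC.sqrt Λ, ?_⟩
  have h2 := (Matrix.nonneg_iff_posSemidef.1 (CFC.sqrt_nonneg Λ)).1
  rw [Matrix.IsHermitian, Matrix.conjTranspose_eq_transpose_of_trivial] at h2
  rw [h2, CFC.sqrt_mul_sqrt_self Λ (Matrix.nonneg_iff_posSemidef.2 h)]

theorem map_C_evalAt {m : Type} (B : Matrix m m ℝ) (z : ℂ) :
    (B.map RatFunc.C).map (evalAt z) = B.map (fun x : ℝ => (x : ℂ)) := by
  ext i j
  simp [evalAt_C]

/-- Two stable minimum phase factors of the same spectrum differ by a constant matrix. -/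
theorem spectral_factor_unique {F₀ F₁ : Matrix m m (RatFunc ℝ)} {Λ₀ Λ₁ : Matrix m m ℝ}
    (hs₀ : ∀ i j, IsStable (F₀ i j)) (hs₁ : ∀ i j, IsStable (F₁ i j))
    (hp₀ : ∀ i j, IsProper (F₀ i j)) (hp₁ : ∀ i j, IsProper (F₁ i j))
    (hm₀ : IsMinimumPhase F₀) (hm₁ : IsMinimumPhase F₁)
    (hd₀ : (F₀.map valInfty).det ≠ 0) (hd₁ : (F₁.map valInfty).det ≠ 0)
    (hΛ₀ : Λ₀.PosSemidef) (hΛ₁ : Λ₁.PosSemidef) (hΛd₀ : Λ₀.det ≠ 0) (hΛd₁ : Λ₁.det ≠ 0)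
    (h : ∀ z : ℂ, ‖z‖ = 1 → F₀.map (evalAt z) * Λ₀.map (fun x : ℝ => (x : ℂ)) *
        (F₀.map (evalAt z)).conjTranspose =
      F₁.map (evalAt z) * Λ₁.map (fun x : ℝ => (x : ℂ)) * (F₁.map (evalAt z)).conjTranspose) :
    ∃ Q : Matrix m m ℝ, F₀ = F₁ * Q.map RatFunc.C ∧ Q * Λ₀ * Q.transpose = Λ₁ := by
  obtain ⟨B₀, hB₀⟩ := exists_eq_mul_transpose hΛ₀
  obtain ⟨B₁, hB₁⟩ := exists_eq_mul_transpose hΛ₁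
  have hBu : ∀ {Λ B : Matrix m m ℝ}, Λ = B * B.transpose → Λ.det ≠ 0 → IsUnit B.det := by
    rintro Λ B rfl h0
    rw [Matrix.det_mul, Matrix.det_transpose] at h0
    exact isUnit_iff_ne_zero.2 fun hz => h0 (by simp [hz])
  have hu₀ := hBu hB₀ hΛd₀
  have hu₁ := hBu hB₁ hΛd₁
  have hCs : ∀ (B : Matrix m m ℝ) (S : Set ℂ) i j, (B.map RatFunc.C) i j ∈ regularSubring S :=
    fun B S i j => C_mem_regularSubring S _
  have hCp : ∀ (B : Matrix m m ℝ) i j, IsProper ((B.map RatFunc.C) i j) :=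
    fun B i j => isProper_C _
  have hCmul : ∀ B B' : Matrix m m ℝ, B.map RatFunc.C * B'.map RatFunc.C =
      (B * B').map RatFunc.C := fun B B' => (Matrix.map_mul).symm
  have hCone : (1 : Matrix m m ℝ).map RatFunc.C = (1 : Matrix m m (RatFunc ℝ)) :=
    Matrix.map_one _ (map_zero _) (map_one _)
  have hEs : ∀ {F : Matrix m m (RatFunc ℝ)} (B : Matrix m m ℝ), (∀ i j, IsStable (F i j)) →
      ∀ i j, IsStable ((F * B.map RatFunc.C) i j) := fun B hF i j =>
    isStable_iff.2 (mul_apply_mem (fun i j => isStable_iff.1 (hF i j)) (hCs B _) i j)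
  have hJs : ∀ {F : Matrix m m (RatFunc ℝ)} (B : Matrix m m ℝ), IsMinimumPhase F →
      ∀ i j, (B⁻¹.map RatFunc.C * F⁻¹) i j ∈ regularSubring {z | 1 < ‖z‖} := fun B hF i j =>
    mul_apply_mem (hCs _ _) (fun i j z (hz : 1 < ‖z‖) h0 => absurd (hF.2 i j z h0)
      (not_le.2 hz)) i j
  have hJE : ∀ {F : Matrix m m (RatFunc ℝ)} {B : Matrix m m ℝ}, IsMinimumPhase F →
      IsUnit B.det → (B⁻¹.map RatFunc.C * F⁻¹) * (F * B.map RatFunc.C) = 1 := by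
    intro F B hF hB
    rw [Matrix.mul_assoc, ← Matrix.mul_assoc F⁻¹, Matrix.nonsing_inv_mul _ hF.1, Matrix.one_mul,
      hCmul, Matrix.nonsing_inv_mul _ hB, hCone]
  have hEE : ∀ z : ℂ, ‖z‖ = 1 → ∀ {F : Matrix m m (RatFunc ℝ)} {Λ B : Matrix m m ℝ},
      Λ = B * B.transpose → (∀ i j, IsStable (F i j)) →
      (F * B.map RatFunc.C).map (evalAt z) *
        ((F * B.map RatFunc.C).map (evalAt z)).conjTranspose =
      F.map (evalAt z) * Λ.map (fun x : ℝ => (x : ℂ)) * (F.map (evalAt z)).conjTranspose := by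
    intro z hz F Λ B hΛ hF
    have hz' : ∀ w ∈ ({z} : Set ℂ), 1 ≤ ‖w‖ := by
      rintro w rfl
      exact hz.ge
    rw [map_evalAt_mul (fun i j => mem_regularSubring_of_isStable (hF i j) hz') (hCs _ _),
      map_C_evalAt, Matrix.conjTranspose_mul, hΛ]
    have e : (B * B.transpose).map (fun x : ℝ => (x : ℂ)) =
        B.map (fun x : ℝ => (x : ℂ)) * (B.map (fun x : ℝ => (x : ℂ))).conjTranspose := by
      ext i j
      simp [Matrix.mul_apply]
    rw [e]
    simp only [Matrix.mul_assoc]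
  have hfac : ∀ z : ℂ, ‖z‖ = 1 → (F₀ * B₀.map RatFunc.C).map (evalAt z) *
        ((F₀ * B₀.map RatFunc.C).map (evalAt z)).conjTranspose =
      (F₁ * B₁.map RatFunc.C).map (evalAt z) *
        ((F₁ * B₁.map RatFunc.C).map (evalAt z)).conjTranspose := by
    intro z hz
    rw [hEE z hz hB₀ hs₀, hEE z hz hB₁ hs₁, h z hz]
  set E₀ := F₀ * B₀.map RatFunc.C with hE₀
  set E₁ := F₁ * B₁.map RatFunc.C with hE₁
  set J₀ := B₀⁻¹.map RatFunc.C * F₀⁻¹ with hJ₀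
  set J₁ := B₁⁻¹.map RatFunc.C * F₁⁻¹ with hJ₁
  have hJE₀ : J₀ * E₀ = 1 := hJE hm₀ hu₀
  have hJE₁ : J₁ * E₁ = 1 := hJE hm₁ hu₁
  obtain ⟨hQs, Z, hZ, hQ⟩ := quotient_unitary (hEs B₀ hs₀) (hEs B₁ hs₁) (hJs B₁ hm₁) hJE₁ hfac
  obtain ⟨hQs', Z', hZ', hQ'⟩ := quotient_unitary (hEs B₁ hs₁) (hEs B₀ hs₀) (hJs B₀ hm₀) hJE₀
    (fun z hz => (hfac z hz).symm)
  have hQp : ∀ i j, IsProper ((J₁ * E₀) i j) := isProper_mul_apply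
    (isProper_mul_apply (hCp _) (isProper_inv_apply hp₁ hd₁)) (isProper_mul_apply hp₀ (hCp _))
  have hQp' : ∀ i j, IsProper ((J₀ * E₁) i j) := isProper_mul_apply
    (isProper_mul_apply (hCp _) (isProper_inv_apply hp₀ hd₀)) (isProper_mul_apply hp₁ (hCp _))
  have hEJ₀ : E₀ * J₀ = 1 := mul_eq_one_comm.1 hJE₀
  have hQQ : (J₁ * E₀) * (J₀ * E₁) = 1 := by
    rw [Matrix.mul_assoc, ← Matrix.mul_assoc E₀, hEJ₀, Matrix.one_mul, hJE₁]
  -- The quotient is unitary on the circle, so its inverse `J₀ * E₁`, also stable and proper, is its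
  -- conjugate transpose there.
  have hconst : ∀ i j, ∃ c, (J₁ * E₀) i j = RatFunc.C c := by
    intro i j
    refine eq_C_of_conj_eq (hQs i j) (hQp i j) (hQs' j i) (hQp' j i) hZ fun z hz hzZ => ?_
    have hz' : ∀ w ∈ ({z} : Set ℂ), 1 ≤ ‖w‖ := by
      rintro w rfl
      exact hz.ge
    have h1 := congrArg (fun A => A.map (evalAt z)) hQQ
    rw [map_evalAt_mul (fun i j => mem_regularSubring_of_isStable (hQs i j) hz')
      (fun i j => mem_regularSubring_of_isStable (hQs' i j) hz'), map_evalAt_one] at h1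
    have h2 := left_inv_eq_right_inv (mul_eq_one_comm.1 (hQ z hz hzZ)) h1
    have h3 := congrFun (congrFun h2 j) i
    rw [Matrix.conjTranspose_apply, Matrix.map_apply, Matrix.map_apply] at h3
    rw [← h3]
    exact (Complex.conj_conj _).symm
  choose q hq using hconst
  let Qc : Matrix m m ℝ := q
  have hQc : J₁ * E₀ = Qc.map RatFunc.C := by
    ext i j
    exact hq i j
  have hQorth : Qc * Qc.transpose = 1 := by
    obtain ⟨z, hz, hzZ⟩ := ((isPreconnected_unitCircle.infinite_of_nontrivial
      unitCircle_nontrivial).sdiff hZ).nonempty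
    have h1 := hQ z (by simpa using hz) hzZ
    rw [hQc, map_C_evalAt] at h1
    ext i j
    have h2 := congrFun (congrFun h1 i) j
    simp only [Matrix.mul_apply, Matrix.conjTranspose_apply, Matrix.map_apply, RCLike.star_def,
      Complex.conj_ofReal] at h2
    simp only [Matrix.mul_apply, Matrix.transpose_apply]
    have h3 : ((1 : Matrix m m ℂ) i j) = (((1 : Matrix m m ℝ) i j : ℝ) : ℂ) := by
      by_cases hij : i = j
      · rw [hij, Matrix.one_apply_eq, Matrix.one_apply_eq, Complex.ofReal_one]
      · rw [Matrix.one_apply_ne hij, Matrix.one_apply_ne hij, Complex.ofReal_zero]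
    rw [h3] at h2
    exact_mod_cast h2
  have hEq : F₀ * B₀.map RatFunc.C = F₁ * B₁.map RatFunc.C * Qc.map RatFunc.C := by
    rw [← hQc, ← hE₀, ← hE₁, ← Matrix.mul_assoc, mul_eq_one_comm.1 hJE₁, Matrix.one_mul]
  -- The orthogonal factor relates the normalized factors F B; undoing the normalization by the
  -- roots of the covariances gives the witness.
  refine ⟨B₁ * Qc * B₀⁻¹, ?_, ?_⟩
  · have := congrArg (fun A => A * B₀⁻¹.map RatFunc.C) hEq
    simp only [Matrix.mul_assoc, hCmul] at this
    rw [Matrix.mul_nonsing_inv _ hu₀, hCone, Matrix.mul_one] at this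
    rw [this, Matrix.mul_assoc]
  · rw [hB₀, hB₁, Matrix.transpose_mul, Matrix.transpose_mul]
    have h1 : B₀⁻¹ * B₀ = 1 := Matrix.nonsing_inv_mul _ hu₀
    have h2 : B₀.transpose * B₀⁻¹.transpose = 1 := by
      rw [← Matrix.transpose_mul, h1, Matrix.transpose_one]
    calc B₁ * Qc * B₀⁻¹ * (B₀ * B₀.transpose) * (B₀⁻¹.transpose * (Qc.transpose * B₁.transpose))
        = B₁ * Qc * (B₀⁻¹ * B₀) * (B₀.transpose * B₀⁻¹.transpose) * Qc.transpose *
          B₁.transpose := by simp only [Matrix.mul_assoc]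
      _ = B₁ * (Qc * Qc.transpose) * B₁.transpose := by
          rw [h1, h2]; simp only [Matrix.mul_assoc, Matrix.one_mul]
      _ = B₁ * B₁.transpose := by rw [hQorth, Matrix.mul_one]

end Factors

/-! ### Triangular matrices with respect to an injective ordering of the indices. -/

section Triangular

variable {m α R : Type*} [Fintype m] [LinearOrder α] [Field R]

theorem blockTriangular_mul_diag {A B : Matrix m m R} {b : m → α} (hb : Function.Injective b)
    (hA : A.BlockTriangular b) (hB : B.BlockTriangular b) (i : m) :
    (A * B) i i = A i i * B i i := by
  rw [Matrix.mul_apply]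
  apply Finset.sum_eq_single i
  · intro k _ hk
    rcases lt_or_gt_of_ne (fun h => hk (hb h) : b k ≠ b i) with h | h
    · rw [hA h, zero_mul]
    · rw [hB h, mul_zero]
  · exact fun h => absurd (Finset.mem_univ _) h

variable [DecidableEq m]

theorem blockTriangular_inv {A : Matrix m m R} {b : m → α} (hA : A.BlockTriangular b)
    (h : IsUnit A.det) : A⁻¹.BlockTriangular b := by
  let _ := A.invertibleOfIsUnitDet h
  exact Matrix.blockTriangular_inv_of_blockTriangular hA

theorem blockTriangular_inv_diag {A : Matrix m m R} {b : m → α} (hb : Function.Injective b)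
    (hA : A.BlockTriangular b) (h : IsUnit A.det) (h1 : ∀ i, A i i = 1) (i : m) :
    A⁻¹ i i = 1 := by
  have := blockTriangular_mul_diag hb hA (blockTriangular_inv hA h) i
  rw [Matrix.mul_nonsing_inv _ h, Matrix.one_apply_eq, h1, one_mul] at this
  exact this.symm

theorem det_eq_one_of_unitriangular [Fintype α] {A : Matrix m m R} {b : m → α}
    (hb : Function.Injective b) (hA : A.BlockTriangular b) (h1 : ∀ i, A i i = 1) : A.det = 1 := by
  rw [hA.det_fintype]
  apply Finset.prod_eq_one
  intro k _
  have : A.toSquareBlock b k = 1 := by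
    ext x y
    obtain rfl : x = y := Subtype.ext (hb (x.2.trans y.2.symm))
    simp [Matrix.toSquareBlock, Matrix.toSquareBlockProp, h1]
  rw [this, Matrix.det_one]

/-- Uniqueness in the `LDLᵀ` decomposition. -/
theorem eq_one_of_unitriangular_of_isDiag [Fintype α] {Q Λ₀ Λ₁ : Matrix m m R} {b : m → α}
    (hb : Function.Injective b) (hQ : Q.BlockTriangular b) (h1 : ∀ i, Q i i = 1)
    (h₀ : Λ₀.IsDiag) (h₁ : Λ₁.IsDiag) (hd : Λ₀.det ≠ 0) (h : Q * Λ₀ * Q.transpose = Λ₁) :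
    Q = 1 := by
  have hu : IsUnit Q.det := by rw [det_eq_one_of_unitriangular hb hQ h1]; exact isUnit_one
  have hinv := blockTriangular_inv hQ hu
  obtain ⟨d₀, rfl⟩ : ∃ d, Λ₀ = Matrix.diagonal d := ⟨_, h₀.diagonal_diag.symm⟩
  obtain ⟨d₁, rfl⟩ : ∃ d, Λ₁ = Matrix.diagonal d := ⟨_, h₁.diagonal_diag.symm⟩
  have hd₀ : ∀ j, d₀ j ≠ 0 := by
    rw [Matrix.det_diagonal] at hd
    exact fun j => Finset.prod_ne_zero_iff.1 hd j (Finset.mem_univ _)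
  -- The two sides are triangular in opposite directions, so both are diagonal.
  have hE : Q * Matrix.diagonal d₀ = Matrix.diagonal d₁ * Q⁻¹.transpose := by
    rw [← h, Matrix.mul_assoc, ← Matrix.transpose_mul, Matrix.nonsing_inv_mul _ hu,
      Matrix.transpose_one, Matrix.mul_one]
  ext i j
  by_cases hij : i = j
  · rw [hij, h1, Matrix.one_apply_eq]
  · rw [Matrix.one_apply_ne hij]
    rcases lt_or_gt_of_ne (fun h => hij (hb h) : b i ≠ b j) with hlt | hlt
    · have := congrFun (congrFun hE i) j
      rw [Matrix.mul_diagonal, Matrix.diagonal_mul, Matrix.transpose_apply, hinv hlt,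
        mul_zero] at this
      exact (mul_eq_zero.1 this).resolve_right (hd₀ j)
    · exact hQ hlt

end Triangular

/-! ### The maps from the external signals to the measured signals -/

theorem det_ne_zero_of_rank {m F : Type*} [Fintype m] [DecidableEq m] [Field F]
    {A : Matrix m m F} (h : A.rank = Fintype.card m) : A.det ≠ 0 := by
  rw [Matrix.rank_eq_finrank_span_row] at h
  have hli : LinearIndependent F A.row := linearIndependent_iff_card_eq_finrank_span.2 h.symm
  rw [Matrix.linearIndependent_rows_iff_isUnit, Matrix.isUnit_iff_isUnit_det] at hli
  exact hli.ne_zero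

namespace ModelSet

variable {n L K : ℕ} {M : ModelSet n L K}

theorem Cmat_mul_apply {S k : Type} [Semiring S] (A : Matrix (Fin L) k S) (a : M.C) (b : k) :
    (M.Cmat S * A) a b = A a b := by
  simp [Matrix.mul_apply, Cmat]

theorem CTH_apply (θ : Fin n → ℝ) (a b : M.C) : M.CTH θ a b = (M.T θ * M.Hfull θ) a b := by
  rw [CTH, Matrix.mul_assoc, Cmat_mul_apply]

theorem CTR_apply (θ : Fin n → ℝ) (a : M.C) (p : Fin K) :
    M.CTR θ a p = (M.T θ * M.Rmat) a p := by
  rw [CTR, Matrix.mul_assoc, Cmat_mul_apply]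

theorem IsValid.isStable_Hfull (hM : M.IsValid) {θ : Fin n → ℝ} (hθ : θ ∈ M.Θ) (a : Fin L)
    (b : M.C) : IsStable (M.Hfull θ a b) := by
  unfold Hfull
  split_ifs with h
  · exact hM.stable_H θ hθ _ _
  · exact isStable_iff.2 (zero_mem _)

theorem IsValid.isProper_Hfull (hM : M.IsValid) {θ : Fin n → ℝ} (hθ : θ ∈ M.Θ) (a : Fin L)
    (b : M.C) : IsProper (M.Hfull θ a b) := by
  unfold Hfull
  split_ifs with h
  · exact hM.proper_H θ hθ _ _
  · exact zero_mem properSubring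

theorem IsValid.isProper_T (hM : M.IsValid) {θ : Fin n → ℝ} (hθ : θ ∈ M.Θ) (a b : Fin L) :
    IsProper (M.T θ a b) :=
  isProper_inv_apply (hM.isProper_one_sub_G hθ)
    (by rw [hM.map_valInfty_one_sub_G hθ]; exact hM.det_one_sub_Ginfty_ne_zero hθ) a b

theorem IsValid.map_valInfty_T (hM : M.IsValid) {θ : Fin n → ℝ} (hθ : θ ∈ M.Θ) :
    (M.T θ).map valInfty = (1 - M.Ginfty θ)⁻¹ := by
  rw [T, map_valInfty_inv (hM.isProper_one_sub_G hθ)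
    (by rw [hM.map_valInfty_one_sub_G hθ]; exact hM.det_one_sub_Ginfty_ne_zero hθ),
    hM.map_valInfty_one_sub_G hθ]

theorem IsValid.isStable_CTH (hM : M.IsValid) {θ : Fin n → ℝ} (hθ : θ ∈ M.Θ) (a b : M.C) :
    IsStable (M.CTH θ a b) := by
  rw [CTH_apply, isStable_iff]
  exact mul_apply_mem (fun a b => isStable_iff.1 (hM.stable_T θ hθ a b))
    (fun a b => isStable_iff.1 (hM.isStable_Hfull hθ a b)) _ _

theorem IsValid.isProper_CTH (hM : M.IsValid) {θ : Fin n → ℝ} (hθ : θ ∈ M.Θ) (a b : M.C) :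
    IsProper (M.CTH θ a b) := by
  rw [CTH_apply]
  exact isProper_mul_apply (hM.isProper_T hθ) (hM.isProper_Hfull hθ) _ _

/-- As the noise model is monic, [H; 0] at infinity merely selects the columns in `M.C`. -/
theorem IsValid.map_valInfty_CTH (hM : M.IsValid) {θ : Fin n → ℝ} (hθ : θ ∈ M.Θ) :
    (M.CTH θ).map valInfty = (1 - M.Ginfty θ)⁻¹.submatrix (fun a : M.C => (a : Fin L))
      (fun a : M.C => (a : Fin L)) := by
  ext a b
  rw [Matrix.map_apply, CTH_apply, ← Matrix.map_apply (f := valInfty) (M := M.T θ * M.Hfull θ),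
    map_valInfty_mul (hM.isProper_T hθ) (hM.isProper_Hfull hθ), hM.map_valInfty_T hθ,
    Matrix.mul_apply, Matrix.submatrix_apply]
  have hH : ∀ k : Fin L, (M.Hfull θ).map valInfty k b = if k = b then 1 else 0 := by
    intro k
    rw [Matrix.map_apply, Hfull]
    by_cases hk : k ∈ M.C
    · rw [dif_pos hk]
      have := congrFun (congrFun (hM.monic_H θ hθ) ⟨k, hk⟩) b
      rw [Matrix.map_apply] at this
      rw [this, Matrix.one_apply]
      simp [Subtype.ext_iff]
    · rw [dif_neg hk, valInfty_zero, if_neg]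
      rintro rfl
      exact hk b.2
  simp only [hH, mul_ite, mul_one, mul_zero, Finset.sum_ite_eq', Finset.mem_univ, if_true]

theorem IsValid.CΦC_eq (hM : M.IsValid) {θ : Fin n → ℝ} (hθ : θ ∈ M.Θ) (ω : ℝ) :
    M.CΦC θ ω = (M.CTH θ).map (evalAt (Complex.exp (Complex.I * ω))) *
      (M.Λ θ).map (fun x : ℝ => (x : ℂ)) *
      ((M.CTH θ).map (evalAt (Complex.exp (Complex.I * ω)))).conjTranspose := by
  set z := Complex.exp (Complex.I * ω) with hz
  have hz1 : ∀ w ∈ ({z} : Set ℂ), 1 ≤ ‖w‖ := by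
    rintro w rfl
    rw [hz, mul_comm, Complex.norm_exp_ofReal_mul_I]
  have hF : (M.CTH θ).map (evalAt z) =
      M.Cmat ℂ * ((M.T θ).map (evalAt z) * (M.Hfull θ).map (evalAt z)) := by
    ext a b
    rw [Cmat_mul_apply, Matrix.map_apply, CTH_apply,
      ← Matrix.map_apply (f := evalAt z) (M := M.T θ * M.Hfull θ), map_evalAt_mul]
    · exact fun a b => mem_regularSubring_of_isStable (hM.stable_T θ hθ a b) hz1
    · exact fun a b => mem_regularSubring_of_isStable (hM.isStable_Hfull hθ a b) hz1
  have hC : (M.Cmat ℂ).conjTranspose = (M.Cmat ℂ).transpose := by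
    ext a b
    simp only [Cmat, Matrix.conjTranspose_apply, Matrix.transpose_apply]
    split_ifs <;> simp
  rw [hF, Matrix.conjTranspose_mul (M.Cmat ℂ), hC, CΦC, Φ]
  simp only [Matrix.mul_assoc, ← hz]

/-- One frequency with a full rank spectrum suffices, because the covariance is a factor of the
spectrum. -/
theorem IsValid.det_Λ_ne_zero (hM : M.IsValid) (hfull : M.FullRankSpectrum) {θ : Fin n → ℝ}
    (hθ : θ ∈ M.Θ) : (M.Λ θ).det ≠ 0 := by
  obtain ⟨ω, hω⟩ := (hfull θ hθ).exists
  rw [← Fintype.card_coe] at hω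
  have := det_ne_zero_of_rank hω
  rw [hM.CΦC_eq hθ, Matrix.det_mul, Matrix.det_mul] at this
  intro h0
  apply this
  have : ((M.Λ θ).map (fun x : ℝ => (x : ℂ))).det = 0 := by
    have := (Complex.ofRealHom.map_det (M.Λ θ)).symm
    rw [h0, map_zero] at this
    exact this
  rw [this, mul_zero, zero_mul]

/-- The feedthrough condition makes the minimum phase noise map unique. -/
theorem IsValid.CTH_eq (hM : M.IsValid) (hfull : M.FullRankSpectrum)
    (hfeed : M.FeedthroughCondition) (hphase : ∀ θ ∈ M.Θ, IsMinimumPhase (M.CTH θ))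
    {θ₀ θ₁ : Fin n → ℝ} (h₀ : θ₀ ∈ M.Θ) (h₁ : θ₁ ∈ M.Θ)
    (h : ∀ ω : ℝ, M.CΦC θ₀ ω = M.CΦC θ₁ ω) : M.CTH θ₀ = M.CTH θ₁ := by
  have hcircle : ∀ z : ℂ, ‖z‖ = 1 →
      (M.CTH θ₀).map (evalAt z) * (M.Λ θ₀).map (fun x : ℝ => (x : ℂ)) *
        ((M.CTH θ₀).map (evalAt z)).conjTranspose =
      (M.CTH θ₁).map (evalAt z) * (M.Λ θ₁).map (fun x : ℝ => (x : ℂ)) *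
        ((M.CTH θ₁).map (evalAt z)).conjTranspose := by
    intro z hz
    have hz' : z = Complex.exp (Complex.I * (Complex.arg z : ℝ)) := by
      have := Complex.norm_mul_exp_arg_mul_I z
      rw [hz, Complex.ofReal_one, one_mul, mul_comm] at this
      exact this.symm
    have := h (Complex.arg z)
    rw [hM.CΦC_eq h₀, hM.CΦC_eq h₁, ← hz'] at this
    exact this
  have hfactor : ∀ (hdet : ∀ θ ∈ M.Θ, ((M.CTH θ).map valInfty).det ≠ 0),
      ∃ Q : Matrix M.C M.C ℝ, M.CTH θ₀ = M.CTH θ₁ * Q.map RatFunc.C ∧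
        Q * M.Λ θ₀ * Q.transpose = M.Λ θ₁ ∧
        (M.CTH θ₀).map valInfty = (M.CTH θ₁).map valInfty * Q := by
    intro hdet
    obtain ⟨Q, hQ, hQΛ⟩ := spectral_factor_unique (hM.isStable_CTH h₀) (hM.isStable_CTH h₁)
      (hM.isProper_CTH h₀) (hM.isProper_CTH h₁) (hphase θ₀ h₀) (hphase θ₁ h₁) (hdet θ₀ h₀)
      (hdet θ₁ h₁) (hM.psd_Λ θ₀ h₀) (hM.psd_Λ θ₁ h₁) (hM.det_Λ_ne_zero hfull h₀)
      (hM.det_Λ_ne_zero hfull h₁) hcircle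
    refine ⟨Q, hQ, hQΛ, ?_⟩
    rw [hQ, map_valInfty_mul (hM.isProper_CTH h₁)
      (B := Q.map RatFunc.C) fun i j => isProper_C _]
    congr 1
    ext i j
    exact valInfty_C _
  have hone : ∀ Q : Matrix M.C M.C ℝ, M.CTH θ₀ = M.CTH θ₁ * Q.map RatFunc.C → Q = 1 →
      M.CTH θ₀ = M.CTH θ₁ := by
    rintro Q hQ rfl
    rw [hQ, Matrix.map_one _ (map_zero _) (map_one _), Matrix.mul_one]
  -- Without feedthrough both noise maps equal the identity at infinity, so Q = 1. Otherwise both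
  -- are unitriangular at infinity, hence so is Q, and the diagonal covariances make Q = 1 by
  -- uniqueness of LDLᵀ.
  rcases hfeed with hstrict | ⟨hdiag, σ, hσ⟩
  · have hinf : ∀ θ ∈ M.Θ, (M.CTH θ).map valInfty = 1 := by
      intro θ hθ
      have hG : M.Ginfty θ = 0 := by
        ext a b
        exact coeff_eq_zero_of_degree_lt
          ((hstrict θ hθ a b).trans_le degree_le_natDegree)
      rw [hM.map_valInfty_CTH hθ, hG, sub_zero, inv_one]
      exact Matrix.submatrix_one _ Subtype.val_injective
    obtain ⟨Q, hQ, -, hQi⟩ := hfactor fun θ hθ => by rw [hinf θ hθ]; simp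
    rw [hinf θ₀ h₀, hinf θ₁ h₁, Matrix.one_mul] at hQi
    exact hone Q hQ hQi.symm
  · let b : Fin L → (Fin L)ᵒᵈ := fun a => OrderDual.toDual (σ.symm a)
    have hb : Function.Injective b := OrderDual.toDual.injective.comp σ.symm.injective
    have hbC : Function.Injective (b ∘ fun a : M.C => (a : Fin L)) :=
      hb.comp Subtype.val_injective
    have htri : ∀ θ ∈ M.Θ, (1 - M.Ginfty θ).BlockTriangular b := by
      intro θ hθ
      refine Matrix.BlockTriangular.sub Matrix.blockTriangular_one fun x y hxy => ?_
      have hlt : σ.symm x < σ.symm y := hxy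
      have := hσ θ hθ _ _ hlt
      simpa using this
    have hdg : ∀ θ ∈ M.Θ, ∀ a, (1 - M.Ginfty θ) a a = 1 := by
      intro θ hθ a
      simp [Ginfty, hM.hollow θ hθ a, valInfty_zero]
    have hu : ∀ θ ∈ M.Θ, IsUnit (1 - M.Ginfty θ).det := fun θ hθ =>
      isUnit_iff_ne_zero.2 (hM.det_one_sub_Ginfty_ne_zero hθ)
    have hFtri : ∀ θ ∈ M.Θ, ((M.CTH θ).map valInfty).BlockTriangular
        (b ∘ fun a : M.C => (a : Fin L)) := by
      intro θ hθ
      rw [hM.map_valInfty_CTH hθ]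
      exact (blockTriangular_inv (htri θ hθ) (hu θ hθ)).submatrix
    have hFdg : ∀ θ ∈ M.Θ, ∀ a, (M.CTH θ).map valInfty a a = 1 := by
      intro θ hθ a
      rw [hM.map_valInfty_CTH hθ]
      exact blockTriangular_inv_diag hb (htri θ hθ) (hu θ hθ) (hdg θ hθ) a
    have hFdet : ∀ θ ∈ M.Θ, ((M.CTH θ).map valInfty).det = 1 := fun θ hθ =>
      det_eq_one_of_unitriangular hbC (hFtri θ hθ) (hFdg θ hθ)
    obtain ⟨Q, hQ, hQΛ, hQi⟩ := hfactor fun θ hθ => by rw [hFdet θ hθ]; exact one_ne_zero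
    have hFu : IsUnit ((M.CTH θ₁).map valInfty).det := by rw [hFdet θ₁ h₁]; exact isUnit_one
    have hQtri : Q.BlockTriangular (b ∘ fun a : M.C => (a : Fin L)) := by
      have : Q = ((M.CTH θ₁).map valInfty)⁻¹ * (M.CTH θ₀).map valInfty := by
        rw [hQi, ← Matrix.mul_assoc, Matrix.nonsing_inv_mul _ hFu, Matrix.one_mul]
      rw [this]
      exact (blockTriangular_inv (hFtri θ₁ h₁) hFu).mul (hFtri θ₀ h₀)
    have hQdg : ∀ a, Q a a = 1 := by
      intro a
      have := blockTriangular_mul_diag hbC (hFtri θ₁ h₁) hQtri a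
      rw [← hQi, hFdg θ₀ h₀, hFdg θ₁ h₁, one_mul] at this
      exact this.symm
    exact hone Q hQ (eq_one_of_unitriangular_of_isDiag hbC hQtri hQdg (hdiag θ₀ h₀)
      (hdiag θ₁ h₁) (hM.det_Λ_ne_zero hfull h₀) hQΛ)

/-! ### Identification of a module -/

theorem Text_excitation (θ : Fin n → ℝ) (a : M.C) (p : Fin K) :
    M.Text θ (Sum.inl a) (Sum.inr (Sum.inl p)) = M.CTR θ a p := by
  rw [CTR_apply]
  simp [Text, Xmat, Matrix.mul_apply]

theorem Text_noise (θ : Fin n → ℝ) (a c : M.C) :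
    M.Text θ (Sum.inl a) (Sum.inr (Sum.inr c)) = M.CTH θ a c := by
  rw [CTH_apply]
  simp [Text, Xmat, Matrix.mul_apply]

theorem CTR_eq_T (θ : Fin n → ℝ) (a : M.C) (p : Fin K) : M.CTR θ a p = M.T θ a (M.rpos p) := by
  rw [CTR_apply, Matrix.mul_apply]
  simp [Rmat]

/-- An external signal of out-degree one with a known edge reveals the column of its target. -/
theorem ExcitesKnown.T_eq {x : M.Ext} {k : Fin L} (h : M.ExcitesKnown x k) {θ₀ θ₁ : Fin n → ℝ}
    (h₀ : θ₀ ∈ M.Θ) (h₁ : θ₁ ∈ M.Θ) {a : Fin L}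
    (heq : M.Text θ₀ (Sum.inl a) (Sum.inr x) = M.Text θ₁ (Sum.inl a) (Sum.inr x)) :
    M.T θ₀ a k = M.T θ₁ a k := by
  obtain ⟨hcard, hE, hK⟩ := h
  obtain ⟨v, hv⟩ := Set.ncard_eq_one.1 hcard
  have hzero : ∀ θ ∈ M.Θ, ∀ a, a ≠ k → M.Xmat θ a x = 0 := by
    intro θ hθ a hak
    by_contra hne
    have h1 : (Sum.inl a : M.Vertex) ∈ {v | M.Edge (Sum.inr x) v} :=
      ⟨a, rfl, fun h0 => hne (h0 θ hθ)⟩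
    have h2 : (Sum.inl k : M.Vertex) ∈ {v | M.Edge (Sum.inr x) v} := hE
    rw [hv] at h1 h2
    exact hak (Sum.inl_injective ((Set.mem_singleton_iff.1 h1).trans
      (Set.mem_singleton_iff.1 h2).symm))
  have hT : ∀ θ ∈ M.Θ, M.Text θ (Sum.inl a) (Sum.inr x) = M.T θ a k * M.Xmat θ k x := by
    intro θ hθ
    change (M.T θ * M.Xmat θ) a x = _
    rw [Matrix.mul_apply]
    apply Finset.sum_eq_single k
    · intro b _ hb
      rw [hzero θ hθ b hb, mul_zero]
    · exact fun h => absurd (Finset.mem_univ _) h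
  have hX : M.Xmat θ₀ k x = M.Xmat θ₁ k x := hK θ₀ h₀ θ₁ h₁
  have hne : M.Xmat θ₁ k x ≠ 0 := by
    obtain ⟨k', hk', hne⟩ := hE
    obtain rfl := Sum.inl_injective hk'
    exact fun h0 => hne fun θ hθ => (hK θ hθ θ₁ h₁).trans h0
  rw [hT θ₀ h₀, hT θ₁ h₁, hX] at heq
  exact mul_right_cancel₀ hne heq

/-- Independence on the rows `B` persists on any family of rows that contains them. -/
theorem linearIndepOn_Text {θ : Fin n → ℝ} {A B : Finset M.Vertex} {ρ : Type*} (q : ρ → M.Vertex)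
    (hB : ∀ r ∈ B, r ∈ Set.range q)
    (hker : ∀ c : M.Vertex → RatFunc ℝ, (∀ v ∉ A, c v = 0) →
      (∀ r ∈ B, ∑ v, M.Text θ r v * c v = 0) → c = 0) :
    LinearIndepOn (RatFunc ℝ) (fun v (r : ρ) => M.Text θ (q r) v) A := by
  classical
  rw [linearIndepOn_finset_iff]
  intro f hf v hv
  have h0 := hker (fun v => if v ∈ A then f v else 0) (fun v hv => if_neg hv) (by
    intro r hr
    obtain ⟨s, rfl⟩ := hB r hr
    have := congrFun hf s
    simp only [Finset.sum_apply, Pi.smul_apply, smul_eq_mul, Pi.zero_apply] at this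
    refine Eq.trans ?_ this
    rw [← Finset.sum_subset (Finset.subset_univ A) fun v _ hv => by rw [if_neg hv, mul_zero]]
    exact Finset.sum_congr rfl fun v hv => by rw [if_pos hv, mul_comm])
  have := congrFun h0 v
  simpa [hv] using this

/-- The module `G_ji` coincides for two parameters that cannot be distinguished, if the first one
satisfies the two rank conditions. -/
theorem IsValid.Gmat_eq_of_indistinguishable (hM : M.IsValid) {i j : Fin L} {Xbar : Set M.Ext}
    {Cbar : Set (Fin L)} {D : Finset M.Vertex}
    (hD : IsDisconnecting M.Edge (Sum.inl '' (M.Nplus i \ {j}) ∪ Sum.inr '' Xbar)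
      (Sum.inl '' Cbar) D)
    {θ₀ θ₁ : Fin n → ℝ} (h₀ : θ₀ ∈ M.Θ) (h₁ : θ₁ ∈ M.Θ)
    {A : Finset M.Vertex} (hA : (A : Set M.Vertex) ⊆ Sum.inr '' Xbar) (hAD : A.card = D.card)
    (hkerA : ∀ c : M.Vertex → RatFunc ℝ, (∀ v ∉ A, c v = 0) →
      (∀ r ∈ D, ∑ v, M.Text θ₀ r v * c v = 0) → c = 0)
    (hjD : Sum.inl j ∉ D) {B : Finset M.Vertex} (hB : (B : Set M.Vertex) ⊆ Sum.inl '' Cbar)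
    (hkerB : ∀ c : M.Vertex → RatFunc ℝ, (∀ v ∉ insert (Sum.inl j) D, c v = 0) →
      (∀ r ∈ B, ∑ v, M.Text θ₀ r v * c v = 0) → c = 0)
    (hX : ∀ x ∈ Xbar, ∀ r ∈ Cbar,
      M.Text θ₀ (Sum.inl r) (Sum.inr x) = M.Text θ₁ (Sum.inl r) (Sum.inr x))
    (hi : ∀ r ∈ Cbar, M.T θ₀ r i = M.T θ₁ r i) (hj : ∀ r ∈ Cbar, M.T θ₀ r j = M.T θ₁ r j)
    (hN : ∀ k, M.Edge (Sum.inl i) (Sum.inl k) → k ∉ M.Nplus i →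
      M.Known (Sum.inl i) k ∧ ∀ r ∈ Cbar, M.T θ₀ r k = M.T θ₁ r k) :
    M.Gmat θ₀ j i = M.Gmat θ₁ j i := by
  classical
  have hnoedge : ∀ k, ¬ M.Edge (Sum.inl i) (Sum.inl k) → ∀ θ ∈ M.Θ, M.Gmat θ k i = 0 := by
    intro k hk θ hθ
    by_contra hne
    exact hk ⟨k, rfl, fun h0 => hne (h0 θ hθ)⟩
  by_cases hjE : M.Edge (Sum.inl i) (Sum.inl j)
  swap
  · rw [hnoedge j hjE θ₀ h₀, hnoedge j hjE θ₁ h₁]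
  by_cases hjN : j ∈ M.Nplus i
  swap
  · exact (hN j hjE hjN).1 θ₀ h₀ θ₁ h₁
  obtain ⟨S, hAS, hSD, hSC, hSE⟩ := hD.exists_closed
  have hSC' : ∀ r : Cbar, (Sum.inl (r : Fin L) : M.Vertex) ∉ S := fun r hr =>
    Set.disjoint_left.1 hSC hr ⟨r, r.2, rfl⟩
  let p : (Fin n → ℝ) → M.Vertex → ({r // r ∉ S} → RatFunc ℝ) := fun θ v r => M.Text θ r v
  let P : (Fin n → ℝ) → M.Vertex → (Cbar → RatFunc ℝ) := fun θ v r => M.Text θ (Sum.inl r) v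
  let res : ({r // r ∉ S} → RatFunc ℝ) →ₗ[RatFunc ℝ] (Cbar → RatFunc ℝ) :=
    LinearMap.funLeft _ _ fun r => ⟨Sum.inl r, hSC' r⟩
  have hres : ∀ θ v, res (p θ v) = P θ v := fun θ v => rfl
  have hspan : ∀ θ ∈ M.Θ, ∀ v ∈ S ∪ D, p θ v ∈ Submodule.span (RatFunc ℝ) (p θ '' D) :=
    fun θ hθ v hv => hM.Text_mem_span hθ hSE v hv
  have hspanP : ∀ θ ∈ M.Θ, ∀ v ∈ S ∪ D, P θ v ∈ Submodule.span (RatFunc ℝ) (P θ '' D) := by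
    intro θ hθ v hv
    have := Submodule.mem_map_of_mem (f := res) (hspan θ hθ v hv)
    rwa [Submodule.map_span, ← Set.image_comp] at this
  have hAS' : ∀ v ∈ A, v ∈ S ∪ D := fun v hv => hAS (Or.inr (hA hv))
  have hliB : LinearIndepOn (RatFunc ℝ) (P θ₀) (insert (Sum.inl j) D : Finset M.Vertex) :=
    linearIndepOn_Text (fun r : Cbar => Sum.inl (r : Fin L)) (fun r hr => by
      obtain ⟨a, ha, rfl⟩ := hB hr
      exact ⟨⟨a, ha⟩, rfl⟩) hkerB
  have hliA : LinearIndepOn (RatFunc ℝ) (p θ₀) A :=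
    linearIndepOn_Text (fun r : {r // r ∉ S} => (r : M.Vertex))
      (fun r hr => ⟨⟨r, fun hS => Set.disjoint_left.1 hSD hS hr⟩, rfl⟩) hkerA
  have hliD : LinearIndepOn (RatFunc ℝ) (P θ₀) D :=
    hliB.mono (by exact_mod_cast Finset.subset_insert _ _)
  -- The columns of `A` factor through those of `D`. A relation among them on the rows C̄ becomes a
  -- relation among the independent columns of `D`, hence is trivial, so it already holds on all
  -- rows outside `S`, where the columns of `A` are independent.
  have hliPA : LinearIndepOn (RatFunc ℝ) (P θ₀) A := by
    rw [linearIndepOn_finset_iff]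
    intro f hf
    refine linearIndepOn_finset_iff.1 hliA f ?_
    have hy : ∑ v ∈ A, f v • p θ₀ v ∈ Submodule.span (RatFunc ℝ) (p θ₀ '' D) :=
      Submodule.sum_mem _ fun v hv => Submodule.smul_mem _ _ (hspan θ₀ h₀ v (hAS' v hv))
    rw [Submodule.mem_span_image_finset_iff_exists_fun'] at hy
    obtain ⟨w, hw⟩ := hy
    have hw0 : ∑ d ∈ D, w d • P θ₀ d = 0 := by
      have := congrArg res hw
      simp only [map_sum, map_smul, hres] at this
      rw [this]
      exact hf
    have hw1 := linearIndepOn_finset_iff.1 hliD w hw0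
    rw [← hw]
    exact Finset.sum_eq_zero fun d hd => by rw [hw1 d hd, zero_smul]
  have hPA : ∀ v ∈ A, P θ₀ v = P θ₁ v := by
    intro v hv
    obtain ⟨x, hx, rfl⟩ := hA hv
    ext r
    exact hX x hx r r.2
  have himg : P θ₀ '' A = P θ₁ '' A := Set.image_congr fun v hv => hPA v hv
  -- No genericity at θ₁ is needed: the observed columns of `A` have rank |D|, whereas those of `D`
  -- have rank at most |D|.
  have hspanEq : Submodule.span (RatFunc ℝ) (P θ₁ '' A) =
      Submodule.span (RatFunc ℝ) (P θ₁ '' D) := by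
    apply Submodule.eq_of_le_of_finrank_le
    · rw [Submodule.span_le]
      rintro _ ⟨v, hv, rfl⟩
      exact hspanP θ₁ h₁ v (hAS' v hv)
    · have hle : Module.finrank (RatFunc ℝ) (Submodule.span (RatFunc ℝ) (P θ₁ '' D)) ≤
          D.card := by
        rw [← Finset.coe_image]
        exact (finrank_span_finset_le_card _).trans Finset.card_image_le
      have heq : Module.finrank (RatFunc ℝ) (Submodule.span (RatFunc ℝ) (P θ₀ '' A)) =
          A.card := by
        have h1 : LinearIndependent (RatFunc ℝ) (fun v : A => P θ₀ v) := hliPA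
        have h2 := finrank_span_eq_card h1
        have h3 : Set.range (fun v : A => P θ₀ v) = P θ₀ '' A := by
          ext y
          simp
        rwa [Fintype.card_coe, h3] at h2
      rw [← himg, heq, hAD]
      exact hle
  have hjspan : P θ₀ (Sum.inl j) ∉ Submodule.span (RatFunc ℝ) (P θ₀ '' D) := by
    rw [Finset.coe_insert] at hliB
    exact ((linearIndepOn_insert (by exact_mod_cast hjD)).1 hliB).2
  -- This functional, found at θ₀, serves for both parameters.
  obtain ⟨φ, hφj, hφ⟩ := Submodule.exists_le_ker_of_notMem hjspan
  have hφ₀ : ∀ v ∈ S ∪ D, φ (P θ₀ v) = 0 := fun v hv => hφ (hspanP θ₀ h₀ v hv)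
  have hφ₁ : ∀ v ∈ S ∪ D, φ (P θ₁ v) = 0 := by
    intro v hv
    have h1 := hspanP θ₁ h₁ v hv
    rw [← hspanEq, ← himg] at h1
    refine (Submodule.span_le.2 ?_ : _ ≤ LinearMap.ker φ) h1
    rintro _ ⟨a, ha, rfl⟩
    exact hφ₀ a (hAS' a ha)
  -- The indicator term covers the case that w_i itself is in C̄; it does not depend on θ and
  -- cancels.
  have hcol : ∀ θ ∈ M.Θ, P θ (Sum.inl i) = (fun r : Cbar => if (r : Fin L) = i then 1 else 0) +
      ∑ k, M.Gmat θ k i • P θ (Sum.inl k) := by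
    intro θ hθ
    ext r
    simp only [P, Pi.add_apply, Finset.sum_apply, Pi.smul_apply, smul_eq_mul]
    rw [hM.Text_eq hθ, Fintype.sum_sum_type]
    simp only [extMat_inr, mul_zero, Finset.sum_const_zero, add_zero, Sum.inl.injEq]
    congr 1
    exact Finset.sum_congr rfl fun k _ => by rw [mul_comm, extMat_inl]; rfl
  have hPeq : ∀ k, (∀ r ∈ Cbar, M.T θ₀ r k = M.T θ₁ r k) →
      P θ₀ (Sum.inl k) = P θ₁ (Sum.inl k) := fun k hk => funext fun r => hk r r.2
  have hsum : ∑ k, M.Gmat θ₀ k i * φ (P θ₀ (Sum.inl k)) =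
      ∑ k, M.Gmat θ₁ k i * φ (P θ₁ (Sum.inl k)) := by
    have e := hPeq i hi
    rw [hcol θ₀ h₀, hcol θ₁ h₁] at e
    have := congrArg φ (add_left_cancel e)
    simpa only [map_sum, map_smul, smul_eq_mul] using this
  -- The functional kills the terms of 𝒩_i⁺; for other out-neighbors both the module and the column
  -- agree.
  have hrest : ∀ k, k ≠ j → M.Gmat θ₀ k i * φ (P θ₀ (Sum.inl k)) =
      M.Gmat θ₁ k i * φ (P θ₁ (Sum.inl k)) := by
    intro k hkj
    by_cases hkE : M.Edge (Sum.inl i) (Sum.inl k)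
    swap
    · rw [hnoedge k hkE θ₀ h₀, hnoedge k hkE θ₁ h₁, zero_mul, zero_mul]
    by_cases hkN : k ∈ M.Nplus i
    · have hk : (Sum.inl k : M.Vertex) ∈ S ∪ D := hAS (Or.inl ⟨k, ⟨hkN, hkj⟩, rfl⟩)
      rw [hφ₀ _ hk, hφ₁ _ hk, mul_zero, mul_zero]
    · obtain ⟨hK, hT⟩ := hN k hkE hkN
      have hG : M.Gmat θ₀ k i = M.Gmat θ₁ k i := hK θ₀ h₀ θ₁ h₁
      rw [hG, hPeq k hT]
  rw [← Finset.add_sum_erase _ _ (Finset.mem_univ j), ← Finset.add_sum_erase _ _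
    (Finset.mem_univ j), Finset.sum_congr rfl fun k hk => hrest k (Finset.mem_erase.1 hk).1,
    ← hPeq j hj] at hsum
  exact mul_right_cancel₀ hφj (add_right_cancel hsum)

end ModelSet

end NetId

end

/-! ### The theorem: generic rank conditions combined with the identification of the module. -/

theorem mainTheorem2 {n L K : ℕ} (M : NetId.ModelSet n L K)
    (hvalid : M.IsValid)
    (hfull : M.FullRankSpectrum)
    (hindep : M.IndependentlyParameterized)
    (hfeed : M.FeedthroughCondition)
    (hfixed : M.FixedEntriesRegular)
    (i j : Fin L) (xi xj : M.Ext)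
    (hxi : M.ExcitesKnown xi i) (hxj : M.ExcitesKnown xj j)
    (Xbar : Set M.Ext) (hXbar : Xbar ⊆ M.XNoUnknown j \ {xj})
    (Cbar : Set (Fin L)) (hCbar : Cbar ⊆ M.C)
    (D : Finset M.Vertex)
    (hD : NetId.IsDisconnecting M.Edge
      (Sum.inl '' (M.Nplus i \ {j}) ∪ Sum.inr '' Xbar) (Sum.inl '' Cbar) D)
    (hDC : M.b ({Sum.inl j} ∪ D) (Sum.inl '' Cbar) = D.card + 1)
    (hXD : M.b (Sum.inr '' Xbar) D = D.card)
    (hphase : (∀ θ ∈ M.Θ, NetId.IsMinimumPhase (M.CTH θ)) ∨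
      M.OnlyReferencesUsed i xi xj Xbar) :
    M.GenericallyIdentifiable j i := by
  classical
  obtain ⟨A, B₁, hA, hB₁, hAc, hB₁c, haeA⟩ :=
    NetId.ModelSet.ae_Text_injective hvalid hindep hfixed hXD
  obtain ⟨A₂, B, hA₂, hB, hA₂c, -, haeB⟩ :=
    NetId.ModelSet.ae_Text_injective hvalid hindep hfixed hDC
  -- Cardinalities force the endpoints of the paths from X̄ to be all of `D`, and the starting
  -- points of the paths to C̄ to be all of {w_j} ∪ D, with w_j outside `D`.
  obtain rfl : B₁ = D := Finset.eq_of_subset_of_card_le (by exact_mod_cast hB₁) hB₁c.ge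
  have hA₂sub : A₂ ⊆ insert (Sum.inl j) B₁ := by
    intro v hv
    rcases hA₂ hv with h | h
    · exact Finset.mem_insert.2 (Or.inl h)
    · exact Finset.mem_insert_of_mem h
  have hjD : Sum.inl j ∉ B₁ := by
    intro hj
    have := Finset.card_le_card hA₂sub
    rw [Finset.insert_eq_of_mem hj] at this
    omega
  obtain rfl : A₂ = insert (Sum.inl j) B₁ := Finset.eq_of_subset_of_card_le hA₂sub
    (by rw [Finset.card_insert_of_notMem hjD, hA₂c])
  filter_upwards [haeA, haeB] with θ₀ hθA hθB h₀ θ₁ h₁ hCTR hCΦC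
  have hext : ∀ x : M.Ext, ((∀ θ ∈ M.Θ, NetId.IsMinimumPhase (M.CTH θ)) ∨ x.isLeft) →
      ∀ r ∈ Cbar, M.Text θ₀ (Sum.inl r) (Sum.inr x) = M.Text θ₁ (Sum.inl r) (Sum.inr x) := by
    intro x hx r hr
    rcases x with p | c
    · have h1 := NetId.ModelSet.Text_excitation θ₀ ⟨r, hCbar hr⟩ p
      have h2 := NetId.ModelSet.Text_excitation θ₁ ⟨r, hCbar hr⟩ p
      exact h1.trans ((congrFun (congrFun hCTR _) _).trans h2.symm)
    · have hph := hx.resolve_right (by simp)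
      have hCTH := hvalid.CTH_eq hfull hfeed hph h₀ h₁ hCΦC
      have h1 := NetId.ModelSet.Text_noise θ₀ ⟨r, hCbar hr⟩ c
      have h2 := NetId.ModelSet.Text_noise θ₁ ⟨r, hCbar hr⟩ c
      exact h1.trans ((congrFun (congrFun hCTH _) _).trans h2.symm)
  refine hvalid.Gmat_eq_of_indistinguishable hD h₀ h₁ hA hAc (hθA h₀) hjD hB (hθB h₀) ?_ ?_ ?_ ?_
  · exact fun x hx => hext x (hphase.imp_right fun h => h.2.2.1 x hx)
  · exact fun r hr => hxi.T_eq h₀ h₁ (hext xi (hphase.imp_right fun h => h.1) r hr)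
  · exact fun r hr => hxj.T_eq h₀ h₁ (hext xj (hphase.imp_right fun h => h.2.1) r hr)
  · intro k hkE hkN
    have hk : M.Known (Sum.inl i) k ∧ ∃ x, M.ExcitesKnown x k := by
      by_contra h
      exact hkN ⟨hkE, h⟩
    refine ⟨hk.1, fun r hr => ?_⟩
    rcases hphase with h | h
    · obtain ⟨x, hx⟩ := hk.2
      exact hx.T_eq h₀ h₁ (hext x (Or.inl h) r hr)
    -- An excitation signal enters with weight one at a single vertex, so CTR contains the column of
    -- T at k itself.
    · obtain ⟨p, rfl⟩ := h.2.2.2 k hkE hkN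
      have := congrFun (congrFun hCTR ⟨r, hCbar hr⟩) p
      rwa [NetId.ModelSet.CTR_eq_T, NetId.ModelSet.CTR_eq_T] at this
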